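/- All functions are real-valued and $1$-periodic in $x$, i.e. $x\in S^1=\mathbb R/\mathbb Z$. Let $f:\mathbb R\to\mathbb R$ be $C^\infty$ with $f''\ge\sigma>0$ on $\mathbb R$. For $\nu>0$ consider smooth solutions $u=u(t,x)$, $t\ge 0$, of the generalised Burgers equation $$u_t+(f(u))_x-\nu u_{xx}=0,\qquad u(0,\cdot)=u_0,$$ where $u_0\not\equiv 0$ is $C^\infty$ with $\int_{S^1}u_0=0$, and put $$D=D(u_0)=\max\Big(\Big(\int_{S^1}|u_0|\Big)^{-1},\ \max_{S^1}|(u_0)_x|\Big)>1.$$ Fix $f$, $\sigma$ and a number $D>1$; all constants below depend only on these data and on the constants chosen before them, and never on $\nu$, on $k$, or on $u_0$ with $D(u_0)=D$. (i) There is $\tilde C>0$ such that $\int_{S^1}u_x(t,x)^2\,dx\le\tilde C\nu^{-1}$ for all $t\ge 0$, all $\nu\in(0,1]$, all $u_0$ with $D(u_0)=D$ and every corresponding solution $u$. (ii) For any $\tilde C>0$ as in (i), let $$T_1=\tfrac14D^{-2}\tilde C^{-1},\qquad T_2=\max\big(\tfrac32T_1,\ 2D\sigma^{-1}\big),$$ and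 for a function $A$ of time let $\{A\}=\frac1{T_2-T_1}\int_{T_1}^{T_2}A(t)\,dt$. Given $M\ge 1$, for real $k\ge 1$ define the energy spectrum $$E(k)=\Bigg\{\frac{\sum_{|n|\in[M^{-1}k,\,Mk]}|\hat u(n)|^2}{\sum_{|n|\in[M^{-1}k,\,Mk]}1}\Bigg\},\qquad \hat u(n)=\int_{S^1}e^{-2\pi i n x}u(t,x)\,dx,\ n\in\mathbb Z.$$ Then there is $K>1$ such that for all $C_1,C_2,\nu_0>0$ satisfying $$C_1\le\tfrac14K^{-2},\qquad 5K^2\le\frac{C_1}{C_2}<\frac1{\nu_0}$$ (for instance $\nu_0=\frac16K^{-2}$, $C_1=\frac14K^{-2}$, $C_2=\frac1{20}K^{-4}$) there are $M\ge 1$ and $C>0$ with the following property. For every $u_0$ with $D(u_0)=D$, every $\nu\in(0,\nu_0]$, every corresponding solution $u$, and every real $k\ge 1$ such that $k^{-1}$ belongs to the inertial range $J_2=(C_1\nu,\,C_2]$, $$C^{-1}k^{-2}\le E(k)\le Ck^{-2}.$$ -/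

import Mathlib

open scoped ContDiff

/-! Functions on the circle `ℝ/ℤ` are represented by `1`-periodic functions on `ℝ`, and integrals
over the circle by integrals over `[0, 1]`. -/

namespace Burgers

noncomputable section

/-- An admissible initial condition: a smooth, `1`-periodic function with zero mean value which is
not identically zero. -/
structure IsInitialDatum (u₀ : ℝ → ℝ) : Prop where
  smooth : ContDiff ℝ ∞ u₀
  periodic : Function.Periodic u₀ 1
  zero_mean : ∫ x in (0 : ℝ)..1, u₀ x = 0
  ne_zero : ∃ x, u₀ x ≠ 0

/-- The quantity `D = max (|u₀|_1⁻¹, |u₀|_{1,∞})`, where `|u₀|_1` is the `L_1` norm of `u₀` and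
`|u₀|_{1,∞}` is the `L_∞` norm of its derivative (a supremum, as the derivative is continuous). -/
def datumSize (u₀ : ℝ → ℝ) : ℝ :=
  max (∫ x in (0 : ℝ)..1, |u₀ x|)⁻¹ (⨆ x : ℝ, |deriv u₀ x|)

/-- `u = u(t, x)`, `t ≥ 0`, is a smooth space-periodic solution of the generalised viscous Burgers
equation `u_t + (f(u))_x - ν u_xx = 0` with initial condition `u₀`. The values of `u` at negative
times play no role. -/
structure IsSolution (f : ℝ → ℝ) (ν : ℝ) (u₀ : ℝ → ℝ) (u : ℝ → ℝ → ℝ) : Prop where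
  smooth : ContDiffOn ℝ ∞ (fun p : ℝ × ℝ => u p.1 p.2) (Set.Ici 0 ×ˢ Set.univ)
  periodic : ∀ t, 0 ≤ t → Function.Periodic (u t) 1
  initial : ∀ x, u 0 x = u₀ x
  equation : ∀ t, 0 < t → ∀ x,
    deriv (fun s => u s x) t + deriv (fun y => f (u t y)) x - ν * iteratedDeriv 2 (u t) x = 0

/-- The squared homogeneous Sobolev norm `‖v‖_1² = ∫ (v')²` over the circle. -/
def h1NormSq (v : ℝ → ℝ) : ℝ := ∫ x in (0 : ℝ)..1, (deriv v x) ^ 2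

/-- `Ct` is a constant such that `‖u(t)‖_1² ≤ Ct ν⁻¹` for all `t ≥ 0`, uniformly over the viscosities
`ν ∈ (0, 1]` and over the solutions `u` whose initial condition `u₀` satisfies
`datumSize u₀ = D`. -/
def IsH1Constant (f : ℝ → ℝ) (D Ct : ℝ) : Prop :=
  ∀ u₀ : ℝ → ℝ, IsInitialDatum u₀ → datumSize u₀ = D →
    ∀ ν : ℝ, 0 < ν → ν ≤ 1 → ∀ u : ℝ → ℝ → ℝ, IsSolution f ν u₀ u →
      ∀ t, 0 ≤ t → h1NormSq (u t) ≤ Ct * ν⁻¹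

/-- The initial averaging time `T₁ = (1/4) D⁻² Ct⁻¹`. -/
def T₁ (D Ct : ℝ) : ℝ := 1 / 4 * (D ^ 2)⁻¹ * Ct⁻¹

/-- The final averaging time `T₂ = max ((3/2) T₁, 2 D σ⁻¹)`. -/
def T₂ (σ D Ct : ℝ) : ℝ := max (3 / 2 * T₁ D Ct) (2 * D * σ⁻¹)

/-- The inertial range `J₂ = (C₁ ν, C₂]`. -/
def inertialRange (C₁ C₂ ν : ℝ) : Set ℝ := Set.Ioc (C₁ * ν) C₂

/-- The Fourier coefficient `∫ e^{-2πinx} v(x) dx` over the circle. -/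
def fourierHat (v : ℝ → ℝ) (n : ℤ) : ℂ :=
  fourierCoeffOn (zero_lt_one : (0 : ℝ) < 1) (fun x => (v x : ℂ)) n

open Classical in
/-- The layer of all integers `n` such that `|n| ∈ [M⁻¹ k, M k]`. -/
def layer (M k : ℝ) : Finset ℤ :=
  (Finset.Icc (-⌊M * k⌋) ⌊M * k⌋).filter (fun n => |(n : ℝ)| ∈ Set.Icc (M⁻¹ * k) (M * k))

/-- The restriction to a bounded set of integers in the definition of `layer` is immaterial. -/
theorem mem_layer (M k : ℝ) (n : ℤ) :
    n ∈ layer M k ↔ |(n : ℝ)| ∈ Set.Icc (M⁻¹ * k) (M * k) := by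
  classical
  unfold layer
  rw [Finset.mem_filter, Finset.mem_Icc]
  refine ⟨fun h => h.2, fun h => ⟨?_, h⟩⟩
  have h2 := abs_le.mp h.2
  have ha : n ≤ ⌊M * k⌋ := Int.le_floor.mpr h2.2
  have hb : -n ≤ ⌊M * k⌋ := Int.le_floor.mpr (by push_cast; linarith [h2.1])
  exact ⟨by linarith, ha⟩

/-- The time- and layer-averaged energy spectrum
`E(k) = { (∑_{|n| ∈ [M⁻¹k, Mk]} |û(n)|²) / (∑_{|n| ∈ [M⁻¹k, Mk]} 1) }`, the braces denoting the
average over `t ∈ [S, T]`. -/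
def energySpectrum (S T M : ℝ) (u : ℝ → ℝ → ℝ) (k : ℝ) : ℝ :=
  ⨍ t in S..T, (∑ n ∈ layer M k, ‖fourierHat (u t) n‖ ^ 2) / (∑ _n ∈ layer M k, (1 : ℝ))

end

end Burgers

/-!
The argument rests on one-sided bounds for the slope `u_x`, on an energy count, and on Parseval's
identity; it works with time integrals only, never with individual times.

*A priori bounds.* The maximum principle gives `u_x ≤ D` and Oleinik's estimate `t u_x ≤ σ⁻¹`
(`IsClassical.slope_le`, `IsClassical.mul_slope_le`), and a periodic function of mean zero with slope
at most `B` is bounded by `B`. Moreover `w = ν u_x - f(u)` is the time derivative of a primitive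
of `u`, hence solves a linear equation without zeroth order term and is bounded below by its initial
values (`IsClassical.le_flux`). So `-c ν⁻¹ ≤ u_x ≤ D`, and as `u_x` has mean zero, integrating
`(D - u_x) (u_x + c ν⁻¹) ≥ 0` yields `∫ u_x² ≤ D c ν⁻¹`: the first claim.

*Dissipation.* The initial energy is at least `D⁻²`. By Oleinik's estimate at most a quarter of `D⁻²`
is left at time `T₂`, and by the choice of `T₁` at most half of `D⁻²` is dissipated before `T₁`. Hence
`∫_{T₁}^{T₂} ∫ u_x²` is at least of order `ν⁻¹` (`IsClassical.le_integral_h1`), while the balance for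
`∫ u_x²` shows that `∫_{T₁}^{T₂} ∫ u_xx²` is at most of order `ν⁻³` (`IsClassical.integral_h2_le`).

*Lower bound for the increments.* Let `δ_r(x) = u(x + r) - u(x)`. By Parseval and
`sin² y ≥ y² - y⁴` one has `∫ δ_r² ≥ r² ∫ u_x² - (r⁴ / 4) ∫ u_xx²`, and on average the first term
dominates when `r` is a small multiple of `ν`. Since `δ_r ≤ D r` and `δ_r` has
mean zero, `∫ δ_r² ≤ D r max (-δ_r)`; thus `u` drops by an amount bounded below across some
interval of length `r`. As `u_x ≤ D`, that drop is felt by the increments over every `l ∈ [2 r, C₂]`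
on a set of measure at least `l / 2`, so that `∫ δ_l²` is, on average, at least of order `l`
(`increment_sq_transfer`).

*Spectrum.* A slope bounded above by `D` has `L¹` norm at most `2 D`, so `|n| |û(n)| ≤ D`; this is the
upper bound. By Parseval `∫ δ_l² = ∑ 4 sin²(π n l) |û(n)|²`, and with `l = k⁻¹` the frequencies
outside `[M⁻¹ k, M k]` contribute only `O(l / M)` (`increment_sq_le_layer`). For large `M` the layer
therefore carries energy of order at least `k⁻¹`, spread over at most `3 M k` frequencies.
-/

namespace Burgers

noncomputable section

/-! ### Classical form of a solution -/

/-- The closed half-plane `t ≥ 0` of space-time, on which solutions are defined. -/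
def halfPlane : Set (ℝ × ℝ) := Set.Ici 0 ×ˢ Set.univ

theorem mem_halfPlane {t x : ℝ} (ht : 0 ≤ t) : (t, x) ∈ halfPlane := ⟨ht, trivial⟩

theorem uniqueDiffOn_halfPlane : UniqueDiffOn ℝ halfPlane :=
  (uniqueDiffOn_Ici 0).prod uniqueDiffOn_univ

/-- The derivative in the direction `v` of a function on the closed half-plane, one-sided on the
boundary. -/
def dirDeriv (v : ℝ × ℝ) (F : ℝ × ℝ → ℝ) (p : ℝ × ℝ) : ℝ := fderivWithin ℝ F halfPlane p v

theorem contDiffOn_dirDeriv {F : ℝ × ℝ → ℝ} (hF : ContDiffOn ℝ ∞ F halfPlane) (v : ℝ × ℝ) :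
    ContDiffOn ℝ ∞ (dirDeriv v F) halfPlane :=
  (hF.fderivWithin uniqueDiffOn_halfPlane (by simp)).clm_apply contDiffOn_const

theorem dirDeriv_comm {F : ℝ × ℝ → ℝ} (hF : ContDiffOn ℝ ∞ F halfPlane) (v w : ℝ × ℝ) {p : ℝ × ℝ}
    (hp : p ∈ halfPlane) : dirDeriv v (dirDeriv w F) p = dirDeriv w (dirDeriv v F) p := by
  have h1 : DifferentiableWithinAt ℝ (fderivWithin ℝ F halfPlane) halfPlane p :=
    (hF.fderivWithin uniqueDiffOn_halfPlane (m := ∞) (by simp)).differentiableOn (by simp) p hp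
  have key : ∀ a b : ℝ × ℝ, dirDeriv a (dirDeriv b F) p =
      fderivWithin ℝ (fderivWithin ℝ F halfPlane) halfPlane p a b := by
    intro a b
    unfold dirDeriv
    rw [fderivWithin_clm_apply (uniqueDiffOn_halfPlane p hp) h1 (differentiableWithinAt_const b)]
    simp
  have hs : IsSymmSndFDerivWithinAt ℝ F halfPlane p := by
    refine (hF p hp).isSymmSndFDerivWithinAt
      (by simp only [minSmoothness_of_isRCLikeNormedField]
          exact WithTop.coe_le_coe.2 (le_top : (2 : ℕ∞) ≤ ⊤)) uniqueDiffOn_halfPlane ?_ hp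
    have : closure (interior halfPlane) = halfPlane := by
      simp [halfPlane, interior_prod_eq, closure_prod_eq]
    rwa [this]
  rw [key, key, hs.eq]

theorem hasDerivAt_dirDeriv_space {F : ℝ × ℝ → ℝ} (hF : ContDiffOn ℝ ∞ F halfPlane) {t : ℝ}
    (ht : 0 ≤ t) (x : ℝ) : HasDerivAt (fun y => F (t, y)) (dirDeriv (0, 1) F (t, x)) x := by
  have h1 := ((hF.differentiableOn (by simp)) (t, x) (mem_halfPlane ht)).hasFDerivWithinAt
  have h2 : HasDerivAt (fun y : ℝ => (t, y)) ((0 : ℝ), (1 : ℝ)) x :=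
    (hasDerivAt_const x t).prodMk (hasDerivAt_id x)
  have h3 := h1.comp_hasDerivWithinAt (s := Set.univ) x h2.hasDerivWithinAt
    (fun y _ => mem_halfPlane ht)
  exact hasDerivWithinAt_univ.mp h3

theorem hasDerivAt_dirDeriv_time {F : ℝ × ℝ → ℝ} (hF : ContDiffOn ℝ ∞ F halfPlane) {t : ℝ}
    (ht : 0 < t) (x : ℝ) : HasDerivAt (fun s => F (s, x)) (dirDeriv (1, 0) F (t, x)) t := by
  have h1 := ((hF.differentiableOn (by simp)) (t, x) (mem_halfPlane ht.le)).hasFDerivWithinAt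
  have h2 : HasDerivAt (fun s : ℝ => (s, x)) ((1 : ℝ), (0 : ℝ)) t :=
    (hasDerivAt_id t).prodMk (hasDerivAt_const t x)
  have h3 := h1.comp_hasDerivWithinAt (s := Set.Ici 0) t h2.hasDerivWithinAt
    (fun s hs => mem_halfPlane hs)
  exact h3.hasDerivAt (Ici_mem_nhds ht)

/-- A solution of the generalised Burgers equation together with its space derivatives `u₁`, `u₂`,
`u₃` of orders one, two and three. All functions are continuous on the whole plane; only times
`t ≥ 0` matter, and a solution is brought into this form by freezing it at negative times. The
last field is the equation differentiated once in `x`. -/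
structure IsClassical (f : ℝ → ℝ) (ν : ℝ) (u u₁ u₂ u₃ : ℝ → ℝ → ℝ) : Prop where
  cont₀ : Continuous fun p : ℝ × ℝ => u p.1 p.2
  cont₁ : Continuous fun p : ℝ × ℝ => u₁ p.1 p.2
  cont₂ : Continuous fun p : ℝ × ℝ => u₂ p.1 p.2
  cont₃ : Continuous fun p : ℝ × ℝ => u₃ p.1 p.2
  periodic : ∀ t, Function.Periodic (u t) 1
  space₀ : ∀ t x, HasDerivAt (u t) (u₁ t x) x
  space₁ : ∀ t x, HasDerivAt (u₁ t) (u₂ t x) x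
  space₂ : ∀ t x, HasDerivAt (u₂ t) (u₃ t x) x
  time₀ : ∀ t, 0 < t → ∀ x,
    HasDerivAt (fun s => u s x) (ν * u₂ t x - deriv f (u t x) * u₁ t x) t
  time₁ : ∀ t, 0 < t → ∀ x,
    HasDerivAt (fun s => u₁ s x) (ν * u₃ t x - iteratedDeriv 2 f (u t x) * u₁ t x ^ 2
      - deriv f (u t x) * u₂ t x) t

theorem hasDerivAt_flux {f : ℝ → ℝ} (hf : ContDiff ℝ ∞ f) (y : ℝ) :
    HasDerivAt f (deriv f y) y :=
  ((hf.differentiable (by simp)) y).hasDerivAt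

theorem hasDerivAt_deriv_flux {f : ℝ → ℝ} (hf : ContDiff ℝ ∞ f) (y : ℝ) :
    HasDerivAt (deriv f) (iteratedDeriv 2 f y) y := by
  rw [iteratedDeriv_succ, iteratedDeriv_one]
  have : ContDiff ℝ ∞ (deriv f) := ((contDiff_succ_iff_deriv (n := ∞)).1 (by simpa using hf)).2.2
  exact ((this.differentiable (by simp)) y).hasDerivAt

theorem continuous_deriv_flux {f : ℝ → ℝ} (hf : ContDiff ℝ ∞ f) : Continuous (deriv f) :=
  hf.continuous_deriv (by simp)

theorem continuous_iteratedDeriv_flux {f : ℝ → ℝ} (hf : ContDiff ℝ ∞ f) :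
    Continuous (iteratedDeriv 2 f) := hf.continuous_iteratedDeriv 2
    (WithTop.coe_le_coe.2 (le_top : (2 : ℕ∞) ≤ ⊤))

theorem IsSolution.exists_isClassical {f : ℝ → ℝ} (hf : ContDiff ℝ ∞ f) {ν : ℝ} {u₀ : ℝ → ℝ}
    {u : ℝ → ℝ → ℝ} (hu : IsSolution f ν u₀ u) :
    ∃ u₁ u₂ u₃ : ℝ → ℝ → ℝ, IsClassical f ν (fun t => u (max t 0)) u₁ u₂ u₃ := by
  set F : ℝ × ℝ → ℝ := fun p => u p.1 p.2 with hFdef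
  have hF : ContDiffOn ℝ ∞ F halfPlane := hu.smooth
  set e : ℝ × ℝ := (0, 1) with he
  set e' : ℝ × ℝ := (1, 0) with he'
  have hF1 := contDiffOn_dirDeriv hF e
  have hF2 := contDiffOn_dirDeriv hF1 e
  have hF3 := contDiffOn_dirDeriv hF2 e
  have hcont : ∀ {G : ℝ × ℝ → ℝ}, ContDiffOn ℝ ∞ G halfPlane →
      Continuous fun p : ℝ × ℝ => G (max p.1 0, p.2) := by
    intro G hG
    exact hG.continuousOn.comp_continuous (by fun_prop) fun p => mem_halfPlane (le_max_right _ _)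
  have hmax : ∀ t : ℝ, 0 ≤ max t 0 := fun t => le_max_right _ _
  have hloc : ∀ {G : ℝ × ℝ → ℝ}, ContDiffOn ℝ ∞ G halfPlane → ∀ t, 0 < t → ∀ x,
      HasDerivAt (fun s => G (max s 0, x)) (dirDeriv e' G (t, x)) t := by
    intro G hG t ht x
    refine (hasDerivAt_dirDeriv_time hG ht x).congr_of_eventuallyEq ?_
    filter_upwards [lt_mem_nhds ht] with s hs
    rw [max_eq_left hs.le]
  have htime : ∀ t, 0 < t → ∀ x, dirDeriv e' F (t, x)
      = ν * dirDeriv e (dirDeriv e F) (t, x) - deriv f (u t x) * dirDeriv e F (t, x) := by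
    intro t ht x
    have h := hu.equation t ht x
    have h1 : deriv (fun s => u s x) t = dirDeriv e' F (t, x) :=
      (hasDerivAt_dirDeriv_time hF ht x).deriv
    have h2 : deriv (fun y => f (u t y)) x = deriv f (u t x) * dirDeriv e F (t, x) :=
      ((hasDerivAt_flux hf (u t x)).comp x (hasDerivAt_dirDeriv_space hF ht.le x)).deriv
    have h3 : deriv (u t) = fun y => dirDeriv e F (t, y) :=
      funext fun y => (hasDerivAt_dirDeriv_space hF ht.le y).deriv
    have h4 : iteratedDeriv 2 (u t) x = dirDeriv e (dirDeriv e F) (t, x) := by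
      rw [iteratedDeriv_succ, iteratedDeriv_one, h3]
      exact (hasDerivAt_dirDeriv_space hF1 ht.le x).deriv
    rw [h1, h2, h4] at h
    linarith
  refine ⟨fun t x => dirDeriv e F (max t 0, x), fun t x => dirDeriv e (dirDeriv e F) (max t 0, x),
    fun t x => dirDeriv e (dirDeriv e (dirDeriv e F)) (max t 0, x),
    hcont hF, hcont hF1, hcont hF2, hcont hF3, fun t => hu.periodic _ (hmax t),
    fun t x => hasDerivAt_dirDeriv_space hF (hmax t) x,
    fun t x => hasDerivAt_dirDeriv_space hF1 (hmax t) x,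
    fun t x => hasDerivAt_dirDeriv_space hF2 (hmax t) x, ?_, ?_⟩
  · intro t ht x
    have h := hloc hF t ht x
    rw [htime t ht x] at h
    simpa only [max_eq_left ht.le] using h
  · intro t ht x
    have h := hloc hF1 t ht x
    -- The mixed derivative `u_xt = u_tx` is read off from the equation.
    have h5 : dirDeriv e' (dirDeriv e F) (t, x) = ν * dirDeriv e (dirDeriv e (dirDeriv e F)) (t, x)
        - (iteratedDeriv 2 f (u t x) * dirDeriv e F (t, x) * dirDeriv e F (t, x)
          + deriv f (u t x) * dirDeriv e (dirDeriv e F) (t, x)) := by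
      rw [dirDeriv_comm hF e' e (mem_halfPlane ht.le)]
      have h6 := hasDerivAt_dirDeriv_space (contDiffOn_dirDeriv hF e') ht.le x
      have h7 : (fun y => dirDeriv e' F (t, y)) = fun y =>
          ν * dirDeriv e (dirDeriv e F) (t, y) - deriv f (u t y) * dirDeriv e F (t, y) :=
        funext fun y => htime t ht y
      rw [h7] at h6
      refine h6.unique ?_
      refine ((hasDerivAt_dirDeriv_space hF2 ht.le x).const_mul ν).sub ?_
      exact ((hasDerivAt_deriv_flux hf (u t x)).comp x (hasDerivAt_dirDeriv_space hF ht.le x)).mul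
        (hasDerivAt_dirDeriv_space hF1 ht.le x)
    rw [h5] at h
    simp only [max_eq_left ht.le]
    convert h using 1
    ring

open Set MeasureTheory Filter Topology

/-! ### The maximum principle -/

theorem second_deriv_nonpos_of_forall_le {g g₁ : ℝ → ℝ} {c x₀ : ℝ}
    (hg : ∀ x, HasDerivAt g (g₁ x) x) (hg₁ : HasDerivAt g₁ c x₀) (hmax : ∀ x, g x ≤ g x₀) :
    c ≤ 0 := by
  by_contra! hc
  have h1 : deriv g = g₁ := funext fun x => (hg x).deriv
  have h0 : g₁ x₀ = 0 :=
    IsLocalMax.hasDerivAt_eq_zero (Eventually.of_forall hmax) (hg x₀)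
  have hmin : IsLocalMin g x₀ := isLocalMin_of_deriv_deriv_pos
    (by rw [h1, hg₁.deriv]; exact hc) (by rw [h1, h0]) (hg x₀).continuousAt
  have hconst : g =ᶠ[𝓝 x₀] fun _ => g x₀ := by
    filter_upwards [hmin] with x hx
    exact le_antisymm (hmax x) hx
  have h2 : deriv (deriv g) x₀ = 0 := by
    rw [hconst.deriv.deriv_eq]; simp
  rw [h1, hg₁.deriv] at h2
  exact hc.ne' h2

theorem deriv_nonneg_of_left_max {g : ℝ → ℝ} {c T : ℝ} (hg : HasDerivAt g c T) (hT : 0 < T)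
    (hmax : ∀ s, 0 ≤ s → s ≤ T → g s ≤ g T) : 0 ≤ c := by
  have h1 : Tendsto (slope g T) (𝓝[<] T) (𝓝 c) :=
    hg.tendsto_slope.mono_left (nhdsWithin_mono _ fun s hs => ne_of_lt hs)
  refine ge_of_tendsto h1 ?_
  filter_upwards [Ioo_mem_nhdsLT hT] with s hs
  rw [slope_def_field]
  exact div_nonneg_of_nonpos (by linarith [hmax s hs.1.le hs.2.le]) (by linarith [hs.2])

/-- The maximum principle for functions which are periodic in space: if `g ≤ B` initially, and
if `g ≤ B` at every positive time at every point where the first and second order conditions for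
a maximum over the past hold, then `g ≤ B` for all times. -/
theorem le_of_parabolic_max {g gt g₁ g₂ : ℝ → ℝ → ℝ} {B : ℝ}
    (hg : Continuous fun p : ℝ × ℝ => g p.1 p.2) (hper : ∀ t, Function.Periodic (g t) 1)
    (ht : ∀ t, 0 < t → ∀ x, HasDerivAt (fun s => g s x) (gt t x) t)
    (hx : ∀ t x, HasDerivAt (g t) (g₁ t x) x) (hxx : ∀ t x, HasDerivAt (g₁ t) (g₂ t x) x)
    (h0 : ∀ x, g 0 x ≤ B)
    (hmax : ∀ t, 0 < t → ∀ x, 0 ≤ gt t x → g₁ t x = 0 → g₂ t x ≤ 0 → g t x ≤ B)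
    {t : ℝ} (ht0 : 0 ≤ t) (x : ℝ) : g t x ≤ B := by
  obtain ⟨⟨t₀, x₀⟩, hp, hpmax⟩ := (isCompact_Icc.prod isCompact_Icc :
    IsCompact (Icc (0 : ℝ) t ×ˢ Icc (0 : ℝ) 1)).exists_isMaxOn
      ⟨(0, 0), ⟨le_rfl, ht0⟩, ⟨le_rfl, zero_le_one⟩⟩ hg.continuousOn
  have hle : ∀ s, 0 ≤ s → s ≤ t → ∀ y, g s y ≤ g t₀ x₀ := by
    intro s hs hst y
    obtain ⟨z, hz, hyz⟩ := (hper s).exists_mem_Ico₀ one_pos y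
    rw [hyz]
    exact hpmax (show (s, z) ∈ _ from ⟨⟨hs, hst⟩, ⟨hz.1, hz.2.le⟩⟩)
  refine (hle t ht0 le_rfl x).trans ?_
  rcases hp.1.1.eq_or_lt with h | h
  · dsimp only at h
    rw [← h]; exact h0 x₀
  · have hx0 : ∀ y, g t₀ y ≤ g t₀ x₀ := hle t₀ h.le hp.1.2
    exact hmax t₀ h x₀
      (deriv_nonneg_of_left_max (ht t₀ h x₀) h fun s hs hst => hle s hs (hst.trans hp.1.2) x₀)
      (IsLocalMax.hasDerivAt_eq_zero (Eventually.of_forall hx0) (hx t₀ x₀))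
      (second_deriv_nonpos_of_forall_le (hx t₀) (hxx t₀ x₀) hx0)

theorem periodic_of_hasDerivAt {g g₁ : ℝ → ℝ} (hg : ∀ x, HasDerivAt g (g₁ x) x)
    (hper : Function.Periodic g 1) : Function.Periodic g₁ 1 := by
  intro x
  have h1 : HasDerivAt (fun y => g (y + 1)) (g₁ (x + 1)) x := (hg (x + 1)).comp_add_const x 1
  rw [show (fun y => g (y + 1)) = g from funext hper] at h1
  exact h1.unique (hg x)

/-! ### Functions with a one-sided bound on the derivative -/

theorem sub_le_of_hasDerivAt_le {g g₁ : ℝ → ℝ} {B : ℝ} (hg : ∀ x, HasDerivAt g (g₁ x) x)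
    (hB : ∀ x, g₁ x ≤ B) {x y : ℝ} (hxy : x ≤ y) : g y - g x ≤ B * (y - x) :=
  image_sub_le_mul_sub_of_deriv_le (fun z => (hg z).differentiableAt)
    (fun z => by rw [(hg z).deriv]; exact hB z) hxy

theorem continuous_of_hasDerivAt {g g₁ : ℝ → ℝ} (hg : ∀ x, HasDerivAt g (g₁ x) x) :
    Continuous g := continuous_iff_continuousAt.2 fun x => (hg x).continuousAt

theorem abs_le_of_hasDerivAt_le {g g₁ : ℝ → ℝ} {B : ℝ} (hg : ∀ x, HasDerivAt g (g₁ x) x)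
    (hper : Function.Periodic g 1) (hmean : ∫ x in (0 : ℝ)..1, g x = 0)
    (hB : ∀ x, g₁ x ≤ B) (hB0 : 0 ≤ B) (x : ℝ) : |g x| ≤ B := by
  have hc := continuous_of_hasDerivAt hg
  have hm : ∫ y in x..x + 1, g y = 0 := by
    rw [hper.intervalIntegral_add_eq x 0, zero_add, hmean]
  have hlow : ∫ y in x..x + 1, (g x - B) ≤ ∫ y in x..x + 1, g y := by
    refine intervalIntegral.integral_mono_on (by linarith) (by simp)
      (hc.intervalIntegrable _ _) fun y hy => ?_
    have h := sub_le_of_hasDerivAt_le hg hB hy.2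
    rw [hper x] at h
    nlinarith [hy.1]
  have hup : ∫ y in x..x + 1, g y ≤ ∫ y in x..x + 1, (g x + B) := by
    refine intervalIntegral.integral_mono_on (by linarith) (hc.intervalIntegrable _ _)
      (by simp) fun y hy => ?_
    have h := sub_le_of_hasDerivAt_le hg hB hy.1
    nlinarith [hy.2]
  rw [hm] at hlow hup
  simp only [intervalIntegral.integral_const, add_sub_cancel_left, one_smul] at hlow hup
  exact abs_le.2 ⟨by linarith, by linarith⟩

theorem integral_deriv_periodic {g g₁ : ℝ → ℝ} (hg : ∀ x, HasDerivAt g (g₁ x) x)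
    (hg₁ : Continuous g₁) (hper : Function.Periodic g 1) : ∫ x in (0 : ℝ)..1, g₁ x = 0 := by
  rw [intervalIntegral.integral_eq_sub_of_hasDerivAt (fun x _ => hg x)
    (hg₁.intervalIntegrable _ _)]
  have := hper 0
  rw [zero_add] at this
  rw [this, sub_self]

/-- If a function of mean zero takes values in `[-c, B]`, its mean square is at most `B c`. -/
theorem integral_sq_le_mul {w : ℝ → ℝ} (hw : Continuous w) (hmean : ∫ x in (0 : ℝ)..1, w x = 0)
    {B c : ℝ} (hB : ∀ x, w x ≤ B) (hc : ∀ x, -c ≤ w x) :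
    ∫ x in (0 : ℝ)..1, w x ^ 2 ≤ B * c := by
  have h : 0 ≤ ∫ x in (0 : ℝ)..1, (B - w x) * (w x + c) :=
    intervalIntegral.integral_nonneg zero_le_one fun x _ =>
      mul_nonneg (by linarith [hB x]) (by linarith [hc x])
  have h2 : (∫ x in (0 : ℝ)..1, (B - w x) * (w x + c))
      = (∫ x in (0 : ℝ)..1, ((B - c) * w x + B * c)) - ∫ x in (0 : ℝ)..1, w x ^ 2 := by
    rw [← intervalIntegral.integral_sub ((by fun_prop : Continuous _).intervalIntegrable _ _)
      ((by fun_prop : Continuous _).intervalIntegrable _ _)]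
    exact intervalIntegral.integral_congr fun x _ => by ring
  rw [intervalIntegral.integral_add ((by fun_prop : Continuous _).intervalIntegrable _ _)
    (by simp), intervalIntegral.integral_const_mul, hmean] at h2
  simp only [mul_zero, intervalIntegral.integral_const, sub_zero, one_smul, zero_add] at h2
  linarith

/-! ### Pointwise bounds for the slope of a solution -/

section Slope

variable {f : ℝ → ℝ} {ν σ D : ℝ} {u u₁ u₂ u₃ : ℝ → ℝ → ℝ}

theorem IsClassical.periodic₁ (h : IsClassical f ν u u₁ u₂ u₃) (t : ℝ) :
    Function.Periodic (u₁ t) 1 := periodic_of_hasDerivAt (h.space₀ t) (h.periodic t)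

theorem IsClassical.periodic₂ (h : IsClassical f ν u u₁ u₂ u₃) (t : ℝ) :
    Function.Periodic (u₂ t) 1 := periodic_of_hasDerivAt (h.space₁ t) (h.periodic₁ t)

/-- The slope does not exceed its initial upper bound: at a positive maximum of `u_x` the term
`-f''(u) u_x²` would make `u_x` decrease. -/
theorem IsClassical.slope_le (h : IsClassical f ν u u₁ u₂ u₃) (hν : 0 < ν) (hσ : 0 < σ)
    (hconv : ∀ y, σ ≤ iteratedDeriv 2 f y) (hD : 0 ≤ D) (h0 : ∀ x, u₁ 0 x ≤ D)
    {t : ℝ} (ht : 0 ≤ t) (x : ℝ) : u₁ t x ≤ D := by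
  refine le_of_parabolic_max h.cont₁ h.periodic₁ h.time₁ h.space₁ h.space₂ h0 ?_ ht x
  intro s _ y hs h2 h3
  have h4 := hconv (u s y)
  rw [h2] at hs
  have h5 : σ * u₁ s y ^ 2 ≤ 0 := by nlinarith [sq_nonneg (u₁ s y)]
  have h6 : u₁ s y ^ 2 ≤ 0 := by nlinarith
  nlinarith [sq_nonneg (u₁ s y)]

/-- Oleinik's one-sided estimate: `t u_x ≤ σ⁻¹`, whatever the initial condition. -/
theorem IsClassical.mul_slope_le (h : IsClassical f ν u u₁ u₂ u₃) (hν : 0 < ν) (hσ : 0 < σ)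
    (hconv : ∀ y, σ ≤ iteratedDeriv 2 f y) {t : ℝ} (ht : 0 ≤ t) (x : ℝ) :
    t * u₁ t x ≤ σ⁻¹ := by
  have hc := h.cont₁
  refine le_of_parabolic_max (g := fun t x => t * u₁ t x) (g₁ := fun t x => t * u₂ t x)
    (g₂ := fun t x => t * u₃ t x) (by fun_prop)
    (fun s y => by simp only [h.periodic₁ s y])
    (fun s hs y => (hasDerivAt_id s).mul (h.time₁ s hs y))
    (fun s y => (h.space₁ s y).const_mul s) (fun s y => (h.space₂ s y).const_mul s)
    (fun y => by rw [zero_mul]; positivity) ?_ ht x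
  intro s hs y hst h2 h3
  simp only [id] at hst
  have h2' : u₂ s y = 0 := (mul_eq_zero.1 h2).resolve_left hs.ne'
  have h4 := hconv (u s y)
  rw [h2'] at hst
  have h5 : s * (σ * u₁ s y ^ 2) ≤ u₁ s y := by
    have : s * (σ * u₁ s y ^ 2) ≤ s * (iteratedDeriv 2 f (u s y) * u₁ s y ^ 2) := by gcongr
    nlinarith
  rw [← mul_le_mul_iff_right₀ hσ, mul_inv_cancel₀ hσ.ne']
  by_contra! hlt
  have hpos : 0 < u₁ s y := by
    by_contra! hn
    nlinarith [mul_nonneg hσ.le (mul_nonneg hs.le (neg_nonneg.2 hn))]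
  nlinarith

/-- The function `w = ν u_x - f(u)` solves the linear equation `w_t + f'(u) w_x = ν w_xx`, because
it is the time derivative of a primitive of `u`. Hence it is bounded below by its initial
values. -/
theorem IsClassical.le_flux (h : IsClassical f ν u u₁ u₂ u₃) (hf : ContDiff ℝ ∞ f) (hν : 0 < ν)
    {B : ℝ} (h0 : ∀ x, -B ≤ ν * u₁ 0 x - f (u 0 x)) {t : ℝ} (ht : 0 ≤ t) (x : ℝ) :
    -B ≤ ν * u₁ t x - f (u t x) := by
  have hc0 := h.cont₀
  have hc1 := h.cont₁
  have hcf : Continuous f := hf.continuous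
  -- The term `ε t` turns the weak inequality at a maximum into a contradiction.
  have key : ∀ ε, 0 < ε → f (u t x) - ν * u₁ t x - ε * t ≤ B := by
    intro ε hε
    refine le_of_parabolic_max (g := fun t x => f (u t x) - ν * u₁ t x - ε * t)
      (g₁ := fun t x => deriv f (u t x) * u₁ t x - ν * u₂ t x)
      (g₂ := fun t x => iteratedDeriv 2 f (u t x) * u₁ t x * u₁ t x + deriv f (u t x) * u₂ t x
        - ν * u₃ t x)
      (gt := fun t x => deriv f (u t x) * (ν * u₂ t x - deriv f (u t x) * u₁ t x)
        - ν * (ν * u₃ t x - iteratedDeriv 2 f (u t x) * u₁ t x ^ 2 - deriv f (u t x) * u₂ t x)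
        - ε * 1)
      (by fun_prop) (fun s y => by simp only [h.periodic₁ s y, h.periodic s y]) ?_ ?_ ?_ ?_ ?_ ht x
    · intro s hs y
      exact (((hasDerivAt_flux hf (u s y)).comp s (h.time₀ s hs y)).sub
        ((h.time₁ s hs y).const_mul ν)).sub ((hasDerivAt_id s).const_mul ε)
    · intro s y
      exact (((hasDerivAt_flux hf (u s y)).comp y (h.space₀ s y)).sub
        ((h.space₁ s y).const_mul ν)).sub_const _
    · intro s y
      exact (((hasDerivAt_deriv_flux hf (u s y)).comp y (h.space₀ s y)).mul (h.space₁ s y)).sub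
        ((h.space₂ s y).const_mul ν)
    · intro y
      linarith [h0 y]
    · intro s hs y h1 h2 h3
      exfalso
      have h4 : deriv f (u s y) * (deriv f (u s y) * u₁ s y - ν * u₂ s y) = 0 := by
        rw [h2, mul_zero]
      have h5 := mul_nonpos_of_nonneg_of_nonpos hν.le h3
      nlinarith
  have : f (u t x) - ν * u₁ t x ≤ B := by
    refine le_of_forall_pos_le_add fun ε hε => ?_
    have h1 := key (ε / (t + 1)) (by positivity)
    have h2 : ε / (t + 1) * t ≤ ε := by
      rw [div_mul_eq_mul_div, div_le_iff₀ (by positivity)]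
      nlinarith
    linarith
  linarith

end Slope

/-! ### Integral identities in time -/

theorem continuous_integral_space {G : ℝ → ℝ → ℝ} (hG : Continuous fun p : ℝ × ℝ => G p.1 p.2) :
    Continuous fun t => ∫ x in (0 : ℝ)..1, G t x :=
  intervalIntegral.continuous_parametric_intervalIntegral_of_continuous' (f := G) hG 0 1

theorem integral_space_sub {G Gt : ℝ → ℝ → ℝ} (hG : Continuous fun p : ℝ × ℝ => G p.1 p.2)
    (hGt : Continuous fun p : ℝ × ℝ => Gt p.1 p.2)
    (h : ∀ t, 0 < t → ∀ x, HasDerivAt (fun s => G s x) (Gt t x) t) {a b : ℝ} (ha : 0 ≤ a)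
    (hab : a ≤ b) :
    (∫ x in (0 : ℝ)..1, G b x) - ∫ x in (0 : ℝ)..1, G a x
      = ∫ t in a..b, ∫ x in (0 : ℝ)..1, Gt t x := by
  have h1 : ∀ x, G b x - G a x = ∫ t in a..b, Gt t x := fun x =>
    (intervalIntegral.integral_eq_sub_of_hasDerivAt_of_le hab
      (by fun_prop : Continuous fun s => G s x).continuousOn
      (fun t ht => h t (ha.trans_lt ht.1) x)
      ((by fun_prop : Continuous fun s => Gt s x).intervalIntegrable _ _)).symm
  rw [← intervalIntegral.integral_sub
    ((by fun_prop : Continuous fun x => G b x).intervalIntegrable _ _)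
    ((by fun_prop : Continuous fun x => G a x).intervalIntegrable _ _)]
  simp only [h1]
  rw [intervalIntegral_intervalIntegral_swap]
  have hc : Continuous (Function.uncurry fun x t => Gt t x) := by
    have : Continuous ((fun p : ℝ × ℝ => Gt p.1 p.2) ∘ Prod.swap) := hGt.comp continuous_swap
    exact this
  refine (hc.continuousOn.integrableOn_compact (isCompact_uIcc.prod isCompact_uIcc)).mono_set
    (prod_mono uIoc_subset_uIcc uIoc_subset_uIcc)

section Energy

variable {f : ℝ → ℝ} {ν : ℝ} {u u₁ u₂ u₃ : ℝ → ℝ → ℝ}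

theorem hasDerivAt_primitive {g : ℝ → ℝ} (hg : Continuous g) (y : ℝ) :
    HasDerivAt (fun z => ∫ s in (0 : ℝ)..z, g s) (g y) y :=
  (hg.integral_hasStrictDerivAt 0 y).hasDerivAt

theorem IsClassical.integral_eq_zero (h : IsClassical f ν u u₁ u₂ u₃) (hf : ContDiff ℝ ∞ f)
    (h0 : ∫ x in (0 : ℝ)..1, u 0 x = 0) {t : ℝ} (ht : 0 ≤ t) :
    ∫ x in (0 : ℝ)..1, u t x = 0 := by
  have hc0 := h.cont₀
  have hc1 := h.cont₁
  have hc2 := h.cont₂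
  have hcf := continuous_deriv_flux hf
  have h1 := integral_space_sub h.cont₀ (by fun_prop) h.time₀ le_rfl ht
  have h2 : ∀ s, ∫ x in (0 : ℝ)..1, (ν * u₂ s x - deriv f (u s x) * u₁ s x) = 0 := fun s =>
    integral_deriv_periodic (g := fun x => ν * u₁ s x - f (u s x))
      (fun x => ((h.space₁ s x).const_mul ν).sub
        ((hasDerivAt_flux hf (u s x)).comp x (h.space₀ s x)))
      (by fun_prop) (fun x => by simp only [h.periodic₁ s x, h.periodic s x])
  simp only [h2, intervalIntegral.integral_zero, h0] at h1
  linarith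

/-- The energy balance: the flux does not contribute to the decay of the `L²` norm. -/
theorem IsClassical.energy_eq (h : IsClassical f ν u u₁ u₂ u₃) (hf : ContDiff ℝ ∞ f)
    {t : ℝ} (ht : 0 ≤ t) :
    (∫ x in (0 : ℝ)..1, u t x ^ 2) - ∫ x in (0 : ℝ)..1, u 0 x ^ 2
      = -(2 * ν) * ∫ s in (0 : ℝ)..t, ∫ x in (0 : ℝ)..1, u₁ s x ^ 2 := by
  have hc0 := h.cont₀
  have hc1 := h.cont₁
  have hc2 := h.cont₂
  have hcf := continuous_deriv_flux hf
  rw [integral_space_sub (G := fun t x => u t x ^ 2)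
    (Gt := fun t x => 2 * u t x * (ν * u₂ t x - deriv f (u t x) * u₁ t x)) (by fun_prop)
    (by fun_prop) (fun s hs x => by
      simpa using (h.time₀ s hs x).fun_pow 2) le_rfl ht,
    ← intervalIntegral.integral_const_mul]
  refine intervalIntegral.integral_congr fun s _ => ?_
  have hcg : Continuous fun y => y * deriv f y := by fun_prop
  have h2 := integral_deriv_periodic
    (g := fun x => 2 * ν * (u s x * u₁ s x) - 2 * ∫ y in (0 : ℝ)..u s x, y * deriv f y)
    (fun x => (((h.space₀ s x).mul (h.space₁ s x)).const_mul (2 * ν)).sub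
        (((hasDerivAt_primitive hcg (u s x)).comp x (h.space₀ s x)).const_mul 2))
    (by fun_prop) (fun x => by simp only [h.periodic₁ s x, h.periodic s x])
  have h3 : (∫ x in (0 : ℝ)..1, 2 * u s x * (ν * u₂ s x - deriv f (u s x) * u₁ s x))
      + (2 * ν) * ∫ x in (0 : ℝ)..1, u₁ s x ^ 2 = 0 := by
    refine Eq.trans ?_ h2
    rw [← intervalIntegral.integral_const_mul, ← intervalIntegral.integral_add
      ((by fun_prop : Continuous _).intervalIntegrable _ _)
      ((by fun_prop : Continuous _).intervalIntegrable _ _)]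
    exact intervalIntegral.integral_congr fun x _ => by ring
  linarith

/-- The time-integrated second order estimate, in terms of a bound `F` for `|f'(u)|`. -/
theorem IsClassical.integral_second_le (h : IsClassical f ν u u₁ u₂ u₃) (hf : ContDiff ℝ ∞ f)
    (hν : 0 < ν) {F : ℝ} {a b : ℝ} (ha : 0 ≤ a) (hab : a ≤ b)
    (hF : ∀ t, 0 ≤ t → ∀ x, |deriv f (u t x)| ≤ F) :
    ν * ∫ t in a..b, ∫ x in (0 : ℝ)..1, u₂ t x ^ 2 ≤ (∫ x in (0 : ℝ)..1, u₁ a x ^ 2)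
      + F ^ 2 / ν * ∫ t in a..b, ∫ x in (0 : ℝ)..1, u₁ t x ^ 2 := by
  have hc0 := h.cont₀
  have hc1 := h.cont₁
  have hc2 := h.cont₂
  have hc3 := h.cont₃
  have hcf := continuous_deriv_flux hf
  have hcf2 := continuous_iteratedDeriv_flux hf
  have hb : 0 ≤ ∫ x in (0 : ℝ)..1, u₁ b x ^ 2 :=
    intervalIntegral.integral_nonneg zero_le_one fun x _ => sq_nonneg _
  have h1 := integral_space_sub (G := fun t x => u₁ t x ^ 2)
    (Gt := fun t x => 2 * u₁ t x * (ν * u₃ t x - iteratedDeriv 2 f (u t x) * u₁ t x ^ 2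
      - deriv f (u t x) * u₂ t x)) (by fun_prop)
    (by fun_prop) (fun s hs x => by
      simpa using (h.time₁ s hs x).fun_pow 2) ha hab
  have hcP : Continuous fun t => ∫ x in (0 : ℝ)..1, u₁ t x ^ 2 :=
    continuous_integral_space (G := fun t x => u₁ t x ^ 2) (by fun_prop)
  have hcQ : Continuous fun t => ∫ x in (0 : ℝ)..1, u₂ t x ^ 2 :=
    continuous_integral_space (G := fun t x => u₂ t x ^ 2) (by fun_prop)
  have h2 : ∀ t ∈ Icc a b, (∫ x in (0 : ℝ)..1, 2 * u₁ t x * (ν * u₃ t x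
      - iteratedDeriv 2 f (u t x) * u₁ t x ^ 2 - deriv f (u t x) * u₂ t x))
      ≤ F ^ 2 / ν * (∫ x in (0 : ℝ)..1, u₁ t x ^ 2) - ν * ∫ x in (0 : ℝ)..1, u₂ t x ^ 2 := by
    intro t ht
    have h3 := integral_deriv_periodic
      (g := fun x => 2 * (u₁ t x * (ν * u₂ t x - deriv f (u t x) * u₁ t x)))
      (fun x => ((h.space₁ t x).fun_mul (((h.space₂ t x).const_mul ν).fun_sub
        (((hasDerivAt_deriv_flux hf (u t x)).comp x (h.space₀ t x)).fun_mul
          (h.space₁ t x)))).const_mul 2)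
      (by fun_prop)
      (fun x => by simp only [h.periodic₂ t x, h.periodic₁ t x, h.periodic t x])
    rw [← intervalIntegral.integral_const_mul, ← intervalIntegral.integral_const_mul,
      ← intervalIntegral.integral_sub ((by fun_prop : Continuous _).intervalIntegrable _ _)
      ((by fun_prop : Continuous _).intervalIntegrable _ _)]
    refine le_of_eq_of_le (sub_zero _).symm (le_of_eq_of_le (congrArg _ h3.symm) ?_)
    rw [← intervalIntegral.integral_sub ((by fun_prop : Continuous _).intervalIntegrable _ _)
      ((by fun_prop : Continuous _).intervalIntegrable _ _)]
    refine intervalIntegral.integral_mono_on zero_le_one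
      ((by fun_prop : Continuous _).intervalIntegrable _ _)
      ((by fun_prop : Continuous _).intervalIntegrable _ _) fun x _ => ?_
    have h4 : deriv f (u t x) ^ 2 ≤ F ^ 2 := sq_le_sq' (abs_le.1 (hF t (ha.trans ht.1) x)).1
      (abs_le.1 (hF t (ha.trans ht.1) x)).2
    have h5 : deriv f (u t x) ^ 2 / ν * u₁ t x ^ 2 ≤ F ^ 2 / ν * u₁ t x ^ 2 := by gcongr
    have h6 : 0 ≤ (ν * u₂ t x - deriv f (u t x) * u₁ t x) ^ 2 / ν := by positivity
    have h7 : (ν * u₂ t x - deriv f (u t x) * u₁ t x) ^ 2 / ν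
        = ν * u₂ t x ^ 2 - 2 * deriv f (u t x) * u₁ t x * u₂ t x
          + deriv f (u t x) ^ 2 / ν * u₁ t x ^ 2 := by
      field_simp
      ring
    simp only [Function.comp_apply]
    nlinarith
  have h3 := intervalIntegral.integral_mono_on (μ := volume) hab ((continuous_integral_space
    (G := fun t x => 2 * u₁ t x * (ν * u₃ t x
      - iteratedDeriv 2 f (u t x) * u₁ t x ^ 2 - deriv f (u t x) * u₂ t x))
      (by fun_prop)).intervalIntegrable a b)
    ((by fun_prop : Continuous fun t => F ^ 2 / ν * (∫ x in (0 : ℝ)..1, u₁ t x ^ 2)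
      - ν * ∫ x in (0 : ℝ)..1, u₂ t x ^ 2).intervalIntegrable a b) h2
  rw [← h1, intervalIntegral.integral_sub ((hcP.const_mul _).intervalIntegrable _ _)
    ((hcQ.const_mul _).intervalIntegrable _ _), intervalIntegral.integral_const_mul,
    intervalIntegral.integral_const_mul] at h3
  linarith

end Energy

/-! ### Increments of functions with a one-sided bound on the derivative -/

section Increments

variable {g g₁ : ℝ → ℝ} {D : ℝ}

theorem integral_increment_eq_zero (hg : Continuous g) (hper : Function.Periodic g 1) (r : ℝ) :
    ∫ x in (0 : ℝ)..1, (g (x + r) - g x) = 0 := by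
  rw [intervalIntegral.integral_sub ((by fun_prop : Continuous _).intervalIntegrable _ _)
    (hg.intervalIntegrable _ _), intervalIntegral.integral_comp_add_right, zero_add, add_comm 1 r,
    hper.intervalIntegral_add_eq r 0, zero_add, sub_self]

theorem periodic_increment (hper : Function.Periodic g 1) (r : ℝ) :
    Function.Periodic (fun x => g (x + r) - g x) 1 := by
  intro x
  dsimp only
  rw [hper x, show x + 1 + r = x + r + 1 by ring, hper (x + r)]

/-- As increments are at most `D r` and have mean zero, a large mean square of the increments
forces a large drop of `g` across some interval of length `r`. -/
theorem exists_drop (hg : ∀ x, HasDerivAt g (g₁ x) x) (hper : Function.Periodic g 1)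
    (hD : ∀ x, g₁ x ≤ D) {r : ℝ} (hr : 0 ≤ r) :
    ∃ y, ∫ x in (0 : ℝ)..1, (g (x + r) - g x) ^ 2 ≤ D * r * (g y - g (y + r)) := by
  have hc := continuous_of_hasDerivAt hg
  have hcd : Continuous fun x => g (x + r) - g x := by fun_prop
  obtain ⟨y, -, hy⟩ := isCompact_Icc.exists_isMinOn (nonempty_Icc.2 (zero_le_one (α := ℝ)))
    hcd.continuousOn
  refine ⟨y, integral_sq_le_mul hcd (integral_increment_eq_zero hc hper r) (fun x => ?_)
    fun x => ?_⟩
  · simpa using sub_le_of_hasDerivAt_le hg hD (by linarith : x ≤ x + r)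
  · obtain ⟨z, hz, hxz⟩ := (periodic_increment hper r).exists_mem_Ico₀ one_pos x
    rw [hxz, neg_sub]
    exact hy ⟨hz.1, hz.2.le⟩

/-- A drop across an interval of length `r` makes the increments over the larger distance `l`
negative on an interval of length `l - r`. The square is bounded below by a tangent line, with
slope governed by the free parameter `a`, so that the bound is linear in the drop. -/
theorem le_integral_increment_sq (hg : ∀ x, HasDerivAt g (g₁ x) x) (hper : Function.Periodic g 1)
    (hD : ∀ x, g₁ x ≤ D) (hD0 : 0 ≤ D) {r l a : ℝ} (hr : 0 ≤ r) (hrl : r ≤ l) (hl : l ≤ 1)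
    (ha : 0 ≤ a) (y : ℝ) :
    (l - r) * (2 * a * (g y - g (y + r) - D * l) - a ^ 2)
      ≤ ∫ x in (0 : ℝ)..1, (g (x + l) - g x) ^ 2 := by
  have hc := continuous_of_hasDerivAt hg
  have hcd : Continuous fun x => (g (x + l) - g x) ^ 2 := by fun_prop
  have hp : Function.Periodic (fun x => (g (x + l) - g x) ^ 2) 1 := fun x => by
    have := periodic_increment hper l x
    dsimp only at this ⊢
    rw [this]
  set s := y + r - l with hs
  have h1 : ∫ x in (0 : ℝ)..1, (g (x + l) - g x) ^ 2 = ∫ x in s..s + 1, (g (x + l) - g x) ^ 2 := by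
    rw [hp.intervalIntegral_add_eq s 0, zero_add]
  have h2 : ∫ x in s..y, (g (x + l) - g x) ^ 2 ≤ ∫ x in s..s + 1, (g (x + l) - g x) ^ 2 := by
    refine intervalIntegral.integral_mono_interval le_rfl (by linarith) (by linarith)
      (Eventually.of_forall fun x => sq_nonneg _) (hcd.intervalIntegrable _ _)
  have h3 : ∫ x in s..y, (2 * a * (g y - g (y + r) - D * l) - a ^ 2)
      ≤ ∫ x in s..y, (g (x + l) - g x) ^ 2 := by
    refine intervalIntegral.integral_mono_on (by linarith) (by simp)
      (hcd.intervalIntegrable _ _) fun x hx => ?_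
    have h4 := sub_le_of_hasDerivAt_le hg hD hx.2
    have h5 := sub_le_of_hasDerivAt_le hg hD (by linarith [hx.1] : y + r ≤ x + l)
    have h6 : g (x + l) - g x ≤ -(g y - g (y + r) - D * l) := by nlinarith
    nlinarith [sq_nonneg (g (x + l) - g x + a), mul_le_mul_of_nonneg_left h6 ha]
  rw [intervalIntegral.integral_const, smul_eq_mul] at h3
  have h4 : y - s = l - r := by rw [hs]; ring
  rw [h4] at h3
  linarith

/-- Increments over a larger distance `l` are controlled from below by those over a smaller
distance `r`. -/
theorem increment_sq_transfer (hg : ∀ x, HasDerivAt g (g₁ x) x) (hper : Function.Periodic g 1)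
    (hD : ∀ x, g₁ x ≤ D) (hD0 : 0 < D) {r l a : ℝ} (hr : 0 < r) (hrl : r ≤ l) (hl : l ≤ 1)
    (ha : 0 ≤ a) :
    (l - r) * (2 * a * ((D * r)⁻¹ * (∫ x in (0 : ℝ)..1, (g (x + r) - g x) ^ 2) - D * l) - a ^ 2)
      ≤ ∫ x in (0 : ℝ)..1, (g (x + l) - g x) ^ 2 := by
  obtain ⟨y, hy⟩ := exists_drop hg hper hD hr.le
  refine le_trans ?_ (le_integral_increment_sq hg hper hD hD0.le hr.le hrl hl ha y)
  have h1 : (D * r)⁻¹ * (∫ x in (0 : ℝ)..1, (g (x + r) - g x) ^ 2) ≤ g y - g (y + r) := by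
    rw [inv_mul_le_iff₀ (by positivity)]
    exact hy
  have : 0 ≤ l - r := by linarith
  gcongr

end Increments

/-! ### Fourier coefficients -/

section Fourier

open Complex

theorem fourierHat_eq (v : ℝ → ℝ) (n : ℤ) :
    fourierHat v n = ∫ x in (0 : ℝ)..1, Complex.exp (-(2 * Real.pi * n * x) * I) * v x := by
  unfold fourierHat
  rw [fourierCoeffOn_eq_integral]
  simp only [sub_zero, div_one, one_smul, smul_eq_mul]
  refine intervalIntegral.integral_congr fun x _ => ?_
  rw [fourier_coe_apply]
  congr 2
  push_cast
  ring

theorem norm_exp_neg_mul_I (n : ℤ) (x : ℝ) :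
    ‖Complex.exp (-(2 * Real.pi * n * x) * I)‖ = 1 := by
  have : (-(2 * Real.pi * n * x) : ℂ) = ((-(2 * Real.pi * n * x) : ℝ) : ℂ) := by push_cast; ring
  rw [this, norm_exp_ofReal_mul_I]

theorem norm_fourierHat_le (v : ℝ → ℝ) (n : ℤ) : ‖fourierHat v n‖ ≤ ∫ x in (0 : ℝ)..1, |v x| := by
  rw [fourierHat_eq]
  refine (intervalIntegral.norm_integral_le_integral_norm zero_le_one).trans_eq ?_
  refine intervalIntegral.integral_congr fun x _ => ?_
  simp only [norm_mul, norm_exp_neg_mul_I, one_mul, norm_real, Real.norm_eq_abs]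

/-- Parseval's identity on the circle. -/
theorem hasSum_norm_fourierHat_sq {v : ℝ → ℝ} (hv : Continuous v) :
    HasSum (fun n => ‖fourierHat v n‖ ^ 2) (∫ x in (0 : ℝ)..1, v x ^ 2) := by
  have hc : Continuous fun x => (v x : ℂ) := by fun_prop
  have h1 : MemLp (fun x => (v x : ℂ)) 2 (volume.restrict (Ioc 0 1)) :=
    (memLp_two_iff_integrable_sq_norm hc.aestronglyMeasurable).2
      (by fun_prop : Continuous fun x => ‖(v x : ℂ)‖ ^ 2).integrableOn_Ioc
  have h2 := hasSum_sq_fourierCoeffOn zero_lt_one h1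
  simpa [fourierHat] using h2

theorem fourierHat_deriv {g g₁ : ℝ → ℝ} (hg : ∀ x, HasDerivAt g (g₁ x) x) (hg₁ : Continuous g₁)
    (hper : Function.Periodic g 1) (n : ℤ) :
    fourierHat g₁ n = 2 * Real.pi * n * I * fourierHat g n := by
  rcases eq_or_ne n 0 with rfl | hn
  · rw [fourierHat_eq]
    simp only [Int.cast_zero, mul_zero, zero_mul, neg_zero, Complex.exp_zero, one_mul]
    rw [intervalIntegral.integral_ofReal, integral_deriv_periodic hg hg₁ hper, ofReal_zero]
  · have h := fourierCoeffOn_of_hasDerivAt (zero_lt_one : (0 : ℝ) < 1) hn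
      (f := fun x => (g x : ℂ)) (f' := fun x => (g₁ x : ℂ)) (fun x _ => (hg x).ofReal_comp)
      ((by fun_prop : Continuous fun x => (g₁ x : ℂ)).intervalIntegrable _ _)
    have h0 : g 1 = g 0 := by simpa using hper 0
    unfold fourierHat
    rw [h, h0]
    have hn' : (n : ℂ) ≠ 0 := Int.cast_ne_zero.2 hn
    have hpi : (Real.pi : ℂ) ≠ 0 := ofReal_ne_zero.2 Real.pi_ne_zero
    have hI := I_ne_zero
    push_cast
    field_simp
    ring

theorem norm_fourierHat_deriv_sq {g g₁ : ℝ → ℝ} (hg : ∀ x, HasDerivAt g (g₁ x) x)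
    (hg₁ : Continuous g₁) (hper : Function.Periodic g 1) (n : ℤ) :
    ‖fourierHat g₁ n‖ ^ 2 = (2 * Real.pi * n) ^ 2 * ‖fourierHat g n‖ ^ 2 := by
  rw [fourierHat_deriv hg hg₁ hper, norm_mul, mul_pow]
  congr 1
  have : (2 * Real.pi * n * I : ℂ) = ((2 * Real.pi * n : ℝ) : ℂ) * I := by push_cast; ring
  rw [this, norm_mul, norm_I, mul_one, norm_real, Real.norm_eq_abs, sq_abs]

theorem fourierHat_shift {g : ℝ → ℝ} (hper : Function.Periodic g 1) (r : ℝ) (n : ℤ) :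
    fourierHat (fun x => g (x + r)) n
      = Complex.exp ((2 * Real.pi * n * r : ℝ) * I) * fourierHat g n := by
  rw [fourierHat_eq, fourierHat_eq]
  have hp : Function.Periodic
      (fun x : ℝ => Complex.exp (-(2 * Real.pi * n * x) * I) * (g x : ℂ)) 1 := by
    intro x
    simp only [hper x]
    congr 1
    rw [Complex.exp_eq_exp_iff_exists_int]
    exact ⟨-n, by push_cast; ring⟩
  have h1 := hp.intervalIntegral_add_eq (0 + r) 0
  rw [zero_add 1, show (0 : ℝ) + r + 1 = 1 + r by ring] at h1
  rw [← h1, ← intervalIntegral.integral_comp_add_right (fun x : ℝ =>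
      Complex.exp (-(2 * Real.pi * n * x) * I) * (g x : ℂ)) r,
    ← intervalIntegral.integral_const_mul]
  refine intervalIntegral.integral_congr fun x _ => ?_
  rw [← mul_assoc, ← Complex.exp_add]
  congr 2
  push_cast
  ring

theorem norm_exp_sub_one_sq (θ : ℝ) :
    ‖Complex.exp ((2 * θ : ℝ) * I) - 1‖ ^ 2 = 4 * Real.sin θ ^ 2 := by
  have h := Real.cos_sq' θ
  have h3 := Real.sin_sq_add_cos_sq (2 * θ)
  rw [Complex.sq_norm, Complex.normSq_apply]
  simp only [sub_re, one_re, sub_im, one_im, sub_zero, exp_ofReal_mul_I_re, exp_ofReal_mul_I_im]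
  have h2 := Real.cos_two_mul θ
  nlinarith

theorem norm_fourierHat_increment_sq {g : ℝ → ℝ} (hg : Continuous g)
    (hper : Function.Periodic g 1) (r : ℝ) (n : ℤ) :
    ‖fourierHat (fun x => g (x + r) - g x) n‖ ^ 2
      = 4 * Real.sin (Real.pi * n * r) ^ 2 * ‖fourierHat g n‖ ^ 2 := by
  have h1 : fourierHat (fun x => g (x + r) - g x) n
      = fourierHat (fun x => g (x + r)) n - fourierHat g n := by
    rw [fourierHat_eq, fourierHat_eq, fourierHat_eq, ← intervalIntegral.integral_sub
      ((by fun_prop : Continuous _).intervalIntegrable _ _)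
      ((by fun_prop : Continuous _).intervalIntegrable _ _)]
    refine intervalIntegral.integral_congr fun x _ => ?_
    push_cast
    ring
  rw [h1, fourierHat_shift hper, ← norm_exp_sub_one_sq, ← mul_pow, ← norm_mul]
  congr 2
  rw [sub_mul, one_mul]
  congr 4
  push_cast
  ring

theorem hasSum_increment_sq {g : ℝ → ℝ} (hg : Continuous g) (hper : Function.Periodic g 1)
    (r : ℝ) : HasSum (fun n : ℤ => 4 * Real.sin (Real.pi * n * r) ^ 2 * ‖fourierHat g n‖ ^ 2)
      (∫ x in (0 : ℝ)..1, (g (x + r) - g x) ^ 2) := by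
  have h := hasSum_norm_fourierHat_sq (v := fun x => g (x + r) - g x) (by fun_prop)
  simpa only [norm_fourierHat_increment_sq hg hper] using h

theorem sq_sub_pow_four_le_sin_sq (y : ℝ) : y ^ 2 - y ^ 4 ≤ Real.sin y ^ 2 := by
  wlog hy : 0 ≤ y generalizing y
  · have := this (-y) (by linarith)
    simpa [Real.sin_neg, (by decide : Even 4).neg_pow] using this
  rcases hy.eq_or_lt with rfl | hy0
  · simp
  rcases le_total y 1 with h | h
  · have h1 := Real.sin_gt_sub_cube hy0
    have h2 : 0 ≤ y - y ^ 3 / 6 := by nlinarith [mul_nonneg hy (by nlinarith : 0 ≤ 1 - y ^ 2)]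
    have h3 : (y - y ^ 3 / 6) ^ 2 ≤ Real.sin y ^ 2 := by gcongr
    nlinarith [sq_nonneg (y ^ 2), sq_nonneg (y ^ 3)]
  · nlinarith [sq_nonneg (Real.sin y), mul_nonneg (sq_nonneg y) (by nlinarith : 0 ≤ y ^ 2 - 1)]

/-- On small scales the increments are comparable with the derivative, up to an error governed by
the second derivative. -/
theorem le_integral_increment_sq_of_deriv {g g₁ g₂ : ℝ → ℝ} (hg : ∀ x, HasDerivAt g (g₁ x) x)
    (hg₁ : ∀ x, HasDerivAt g₁ (g₂ x) x) (hg₂ : Continuous g₂) (hper : Function.Periodic g 1)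
    (r : ℝ) :
    r ^ 2 * (∫ x in (0 : ℝ)..1, g₁ x ^ 2) - r ^ 4 / 4 * (∫ x in (0 : ℝ)..1, g₂ x ^ 2)
      ≤ ∫ x in (0 : ℝ)..1, (g (x + r) - g x) ^ 2 := by
  have hc₁ := continuous_of_hasDerivAt hg₁
  have h1 := (hasSum_norm_fourierHat_sq hc₁).mul_left (r ^ 2)
  have h2 := (hasSum_norm_fourierHat_sq hg₂).mul_left (r ^ 4 / 4)
  refine hasSum_le (fun n => ?_) (h1.sub h2) (hasSum_increment_sq (continuous_of_hasDerivAt hg)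
    hper r)
  rw [norm_fourierHat_deriv_sq hg₁ hg₂ (periodic_of_hasDerivAt hg hper),
    norm_fourierHat_deriv_sq hg hc₁ hper]
  have h3 := mul_le_mul_of_nonneg_right (sq_sub_pow_four_le_sin_sq (Real.pi * n * r))
    (sq_nonneg ‖fourierHat g n‖)
  nlinarith

/-- The Fourier coefficients decay like `|n|⁻¹`, as a one-sided bound on the derivative bounds its
`L¹` norm. -/
theorem mul_norm_fourierHat_le {g g₁ : ℝ → ℝ} {D : ℝ} (hg : ∀ x, HasDerivAt g (g₁ x) x)
    (hg₁ : Continuous g₁) (hper : Function.Periodic g 1) (hD : ∀ x, g₁ x ≤ D) (hD0 : 0 ≤ D)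
    (n : ℤ) : (n : ℝ) ^ 2 * ‖fourierHat g n‖ ^ 2 ≤ D ^ 2 := by
  have h1 : ‖fourierHat g₁ n‖ ≤ 2 * D := by
    refine (norm_fourierHat_le g₁ n).trans ?_
    have h2 : ∫ x in (0 : ℝ)..1, |g₁ x| ≤ ∫ x in (0 : ℝ)..1, (2 * D - g₁ x) :=
      intervalIntegral.integral_mono_on zero_le_one
        ((by fun_prop : Continuous _).intervalIntegrable _ _)
        ((by fun_prop : Continuous _).intervalIntegrable _ _)
        fun x _ => abs_le.2 ⟨by linarith, by linarith [hD x]⟩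
    rw [intervalIntegral.integral_sub (by simp) (hg₁.intervalIntegrable _ _),
      integral_deriv_periodic hg hg₁ hper] at h2
    simpa using h2
  have h2 : ‖fourierHat g₁ n‖ ^ 2 ≤ (2 * D) ^ 2 := by gcongr
  rw [norm_fourierHat_deriv_sq hg hg₁ hper] at h2
  have h3 : 1 ≤ Real.pi ^ 2 := by nlinarith [Real.pi_gt_three]
  nlinarith [mul_nonneg (sq_nonneg (n : ℝ)) (sq_nonneg ‖fourierHat g n‖)]

end Fourier

/-! ### Splitting the frequencies -/

theorem sum_natAbs_le {s : Finset ℤ} {t : Finset ℕ} {φ : ℕ → ℝ} (hφ : ∀ m, 0 ≤ φ m)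
    (hst : ∀ n ∈ s, n.natAbs ∈ t) : ∑ n ∈ s, φ n.natAbs ≤ 2 * ∑ m ∈ t, φ m := by
  rw [← Finset.sum_fiberwise_of_maps_to hst, Finset.mul_sum]
  refine Finset.sum_le_sum fun m _ => ?_
  have h1 : ∀ n ∈ s.filter (fun n => n.natAbs = m), φ n.natAbs = φ m := fun n hn => by
    rw [(Finset.mem_filter.1 hn).2]
  rw [Finset.sum_congr rfl h1, Finset.sum_const, nsmul_eq_mul]
  have h2 : (s.filter (fun n => n.natAbs = m)) ⊆ {(m : ℤ), -(m : ℤ)} := by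
    intro n hn
    have := (Finset.mem_filter.1 hn).2
    simp only [Finset.mem_insert, Finset.mem_singleton]
    omega
  have h3 : ((s.filter (fun n => n.natAbs = m)).card : ℝ) ≤ 2 := by
    exact_mod_cast (Finset.card_le_card h2).trans Finset.card_le_two
  exact mul_le_mul_of_nonneg_right h3 (hφ m)

theorem cast_natAbs_real (n : ℤ) : (n.natAbs : ℝ) = |(n : ℝ)| := by
  rw [Nat.cast_natAbs, Int.cast_abs]

theorem card_le_of_abs_le {s : Finset ℤ} {Y : ℝ} (hs : ∀ n ∈ s, n ≠ 0 ∧ |(n : ℝ)| ≤ Y)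
    (hY : 0 ≤ Y) : (s.card : ℝ) ≤ 2 * Y := by
  have h := sum_natAbs_le (s := s) (t := Finset.Ioc 0 ⌊Y⌋₊) (φ := fun _ => (1 : ℝ))
    (fun _ => zero_le_one) fun n hn => by
      obtain ⟨h1, h2⟩ := hs n hn
      rw [Finset.mem_Ioc]
      refine ⟨Int.natAbs_pos.2 h1, Nat.le_floor ?_⟩
      rwa [cast_natAbs_real]
  simp only [Finset.sum_const, nsmul_eq_mul, mul_one, Nat.card_Ioc, tsub_zero] at h
  linarith [Nat.floor_le hY]

theorem sum_inv_sq_le_of_lt_abs {s : Finset ℤ} {X : ℝ} (hX : 0 < X)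
    (hs : ∀ n ∈ s, X < |(n : ℝ)|) : ∑ n ∈ s, ((n : ℝ) ^ 2)⁻¹ ≤ 4 / X := by
  have h := sum_natAbs_le (s := s) (t := Finset.Ioo ⌊X⌋₊ (s.sup Int.natAbs + 1))
    (φ := fun m => ((m : ℝ) ^ 2)⁻¹) (fun m => by positivity) fun n hn => by
      rw [Finset.mem_Ioo]
      refine ⟨(Nat.floor_lt hX.le).2 ?_, Nat.lt_succ_of_le (Finset.le_sup (f := Int.natAbs) hn)⟩
      rw [cast_natAbs_real]
      exact hs n hn
  simp only [cast_natAbs_real, sq_abs] at h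
  have h1 := sum_Ioo_inv_sq_le (α := ℝ) ⌊X⌋₊ (s.sup Int.natAbs + 1)
  have h2 : 2 / ((⌊X⌋₊ : ℝ) + 1) ≤ 2 / X :=
    div_le_div_of_nonneg_left zero_le_two hX (Nat.lt_floor_add_one X).le
  calc _ ≤ _ := h
    _ ≤ 2 * (2 / X) := by gcongr; exact h1.trans h2
    _ = 4 / X := by ring

theorem card_layer_le {M k : ℝ} (hMk : 1 ≤ M * k) : ((layer M k).card : ℝ) ≤ 3 * (M * k) := by
  have h1 : (layer M k).card ≤ (Finset.Icc (-⌊M * k⌋) ⌊M * k⌋).card := by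
    unfold layer
    exact Finset.card_filter_le _ _
  rw [Int.card_Icc] at h1
  have h0 : 0 ≤ ⌊M * k⌋ := Int.floor_nonneg.2 (by linarith)
  have h2 : ((layer M k).card : ℤ) ≤ 2 * ⌊M * k⌋ + 1 := by omega
  have h3 : ((layer M k).card : ℝ) ≤ 2 * (⌊M * k⌋ : ℝ) + 1 := by exact_mod_cast h2
  linarith [Int.floor_le (M * k)]

/-- The increments over the distance `k⁻¹` are carried by the frequencies in the layer around
`k`, up to an error which is small when the layer is wide. -/
theorem increment_sq_le_layer {g g₁ : ℝ → ℝ} {D : ℝ} (hg : ∀ x, HasDerivAt g (g₁ x) x)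
    (hg₁ : Continuous g₁) (hper : Function.Periodic g 1) (hD : ∀ x, g₁ x ≤ D) (hD0 : 0 ≤ D)
    {M k : ℝ} (hM : 0 < M) (hk : 0 < k) :
    ∫ x in (0 : ℝ)..1, (g (x + k⁻¹) - g x) ^ 2
      ≤ 4 * (∑ n ∈ layer M k, ‖fourierHat g n‖ ^ 2) + 100 * D ^ 2 * k⁻¹ / M := by
  classical
  set V : ℤ → ℝ := fun n => ‖fourierHat g n‖ ^ 2 with hV
  have hV0 : ∀ n, 0 ≤ V n := fun n => sq_nonneg _
  have hdecay : ∀ n : ℤ, (n : ℝ) ^ 2 * V n ≤ D ^ 2 := mul_norm_fourierHat_le hg hg₁ hper hD hD0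
  have hpi : Real.pi ^ 2 ≤ 10 := by nlinarith [Real.pi_lt_d2, Real.pi_pos]
  refine hasSum_le_of_sum_le (hasSum_increment_sq (continuous_of_hasDerivAt hg) hper k⁻¹)
    fun s => ?_
  set sL := s.filter fun n : ℤ => n ≠ 0 ∧ |(n : ℝ)| < M⁻¹ * k with hsL
  set sH := s.filter fun n : ℤ => M * k < |(n : ℝ)| with hsH
  set sM := s.filter fun n : ℤ => n ∈ layer M k with hsM
  have hpt : ∀ n ∈ s, 4 * Real.sin (Real.pi * n * k⁻¹) ^ 2 * V n
      ≤ (if n ∈ layer M k then 4 * V n else 0)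
        + (if n ≠ 0 ∧ |(n : ℝ)| < M⁻¹ * k then 40 * D ^ 2 * k⁻¹ ^ 2 else 0)
        + (if M * k < |(n : ℝ)| then 4 * D ^ 2 * ((n : ℝ) ^ 2)⁻¹ else 0) := by
    intro n _
    have hs1 : 4 * Real.sin (Real.pi * n * k⁻¹) ^ 2 * V n ≤ 4 * V n := by
      nlinarith [mul_le_mul_of_nonneg_right (Real.sin_sq_le_one (Real.pi * n * k⁻¹)) (hV0 n)]
    have e1 : (0 : ℝ) ≤ if n ∈ layer M k then 4 * V n else 0 := by
      split_ifs
      · linarith [hV0 n]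
      · exact le_rfl
    have e2 : (0 : ℝ) ≤ if n ≠ 0 ∧ |(n : ℝ)| < M⁻¹ * k then 40 * D ^ 2 * k⁻¹ ^ 2 else 0 := by
      split_ifs <;> positivity
    have e3 : (0 : ℝ) ≤ if M * k < |(n : ℝ)| then 4 * D ^ 2 * ((n : ℝ) ^ 2)⁻¹ else 0 := by
      split_ifs <;> positivity
    rcases lt_or_ge (M * k) |(n : ℝ)| with hH | hH
    · rw [if_pos hH] at e3 ⊢
      have hn2 : 0 < (n : ℝ) ^ 2 := by
        rw [← sq_abs]
        have : 0 < |(n : ℝ)| := lt_of_le_of_lt (by positivity) hH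
        positivity
      have h1 : V n ≤ D ^ 2 * ((n : ℝ) ^ 2)⁻¹ := by
        rw [← div_eq_mul_inv, le_div_iff₀ hn2]
        linarith [hdecay n]
      linarith
    · rcases lt_or_ge |(n : ℝ)| (M⁻¹ * k) with hL | hL
      · rcases eq_or_ne n 0 with rfl | hn
        · have h0 : 4 * Real.sin (Real.pi * ((0 : ℤ) : ℝ) * k⁻¹) ^ 2 * V 0 = 0 := by simp
          linarith
        · rw [if_pos (⟨hn, hL⟩ : n ≠ 0 ∧ |(n : ℝ)| < M⁻¹ * k)] at e2 ⊢
          have h1 : Real.sin (Real.pi * n * k⁻¹) ^ 2 ≤ (Real.pi * n * k⁻¹) ^ 2 :=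
            sq_le_sq.2 Real.abs_sin_le_abs
          have h2 : 4 * Real.sin (Real.pi * n * k⁻¹) ^ 2 * V n
              ≤ 4 * (Real.pi * n * k⁻¹) ^ 2 * V n := by
            have := hV0 n
            gcongr
          have h3 : 4 * (Real.pi * n * k⁻¹) ^ 2 * V n
              = 4 * k⁻¹ ^ 2 * Real.pi ^ 2 * ((n : ℝ) ^ 2 * V n) := by ring
          have h4 : 4 * k⁻¹ ^ 2 * Real.pi ^ 2 * ((n : ℝ) ^ 2 * V n)
              ≤ 4 * k⁻¹ ^ 2 * 10 * D ^ 2 := by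
            have := hdecay n
            have := hV0 n
            gcongr
          linarith
      · rw [if_pos ((mem_layer M k n).2 ⟨hL, hH⟩)] at e1 ⊢
        linarith
  refine (Finset.sum_le_sum hpt).trans ?_
  rw [Finset.sum_add_distrib, Finset.sum_add_distrib, ← Finset.sum_filter, ← Finset.sum_filter,
    ← Finset.sum_filter, Finset.sum_const, nsmul_eq_mul, ← Finset.mul_sum, ← Finset.mul_sum]
  have b1 : ∑ n ∈ sM, V n ≤ ∑ n ∈ layer M k, V n :=
    Finset.sum_le_sum_of_subset_of_nonneg (fun n hn => (Finset.mem_filter.1 hn).2)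
      fun n _ _ => hV0 n
  have b2 : (sL.card : ℝ) ≤ 2 * (M⁻¹ * k) :=
    card_le_of_abs_le (fun n hn => ⟨(Finset.mem_filter.1 hn).2.1, (Finset.mem_filter.1 hn).2.2.le⟩)
      (by positivity)
  have b3 : ∑ n ∈ sH, ((n : ℝ) ^ 2)⁻¹ ≤ 4 / (M * k) :=
    sum_inv_sq_le_of_lt_abs (by positivity) fun n hn => (Finset.mem_filter.1 hn).2
  have c2 : (sL.card : ℝ) * (40 * D ^ 2 * k⁻¹ ^ 2) ≤ 2 * (M⁻¹ * k) * (40 * D ^ 2 * k⁻¹ ^ 2) := by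
    gcongr
  have c3 : 4 * D ^ 2 * ∑ n ∈ sH, ((n : ℝ) ^ 2)⁻¹ ≤ 4 * D ^ 2 * (4 / (M * k)) := by gcongr
  have d2 : 2 * (M⁻¹ * k) * (40 * D ^ 2 * k⁻¹ ^ 2) = 80 * D ^ 2 * k⁻¹ / M := by
    field_simp
    ring
  have d3 : 4 * D ^ 2 * (4 / (M * k)) = 16 * D ^ 2 * k⁻¹ / M := by
    field_simp
    ring
  have d4 : 80 * D ^ 2 * k⁻¹ / M + 16 * D ^ 2 * k⁻¹ / M ≤ 100 * D ^ 2 * k⁻¹ / M := by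
    rw [← add_div]
    gcongr
    nlinarith [mul_nonneg (sq_nonneg D) (inv_pos.2 hk).le]
  linarith

/-! ### Initial data -/

theorem abs_deriv_le_datumSize {u₀ : ℝ → ℝ} (h : IsInitialDatum u₀) (x : ℝ) :
    |deriv u₀ x| ≤ datumSize u₀ := by
  have hc : Continuous fun y => |deriv u₀ y| := (h.smooth.continuous_deriv (by simp)).abs
  have hp : Function.Periodic (fun y => |deriv u₀ y|) 1 := by
    have h1 := periodic_of_hasDerivAt
      (fun y => ((h.smooth.differentiable (by simp)) y).hasDerivAt) h.periodic
    intro y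
    simp only [h1 y]
  have hb : BddAbove (range fun y => |deriv u₀ y|) :=
    (hp.compact_of_continuous one_ne_zero hc).bddAbove
  exact (le_ciSup hb x).trans (le_max_right _ _)

theorem inv_sq_datumSize_le {u₀ : ℝ → ℝ} (h : IsInitialDatum u₀) :
    (datumSize u₀)⁻¹ ^ 2 ≤ ∫ x in (0 : ℝ)..1, u₀ x ^ 2 := by
  have hc : Continuous u₀ := h.smooth.continuous
  set m := ∫ x in (0 : ℝ)..1, |u₀ x| with hm
  have hpos : 0 < m := by
    obtain ⟨x, hx⟩ := h.ne_zero
    obtain ⟨y, hy, hxy⟩ := h.periodic.exists_mem_Ico₀ one_pos x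
    rw [hxy] at hx
    exact intervalIntegral.integral_pos zero_lt_one hc.abs.continuousOn
      (fun z _ => abs_nonneg _) ⟨y, ⟨hy.1, hy.2.le⟩, abs_pos.2 hx⟩
  have h1 : (datumSize u₀)⁻¹ ≤ m := inv_le_of_inv_le₀ hpos (le_max_left _ _)
  have h0 : 0 ≤ (datumSize u₀)⁻¹ :=
    inv_nonneg.2 ((inv_pos.2 hpos).le.trans (le_max_left _ _))
  have h2 : 0 ≤ ∫ x in (0 : ℝ)..1, (|u₀ x| - m) ^ 2 :=
    intervalIntegral.integral_nonneg zero_le_one fun x _ => sq_nonneg _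
  have h3 : ∫ x in (0 : ℝ)..1, (|u₀ x| - m) ^ 2 = (∫ x in (0 : ℝ)..1, u₀ x ^ 2)
      - ∫ x in (0 : ℝ)..1, (2 * m * |u₀ x| - m ^ 2) := by
    rw [← intervalIntegral.integral_sub ((by fun_prop : Continuous _).intervalIntegrable _ _)
      ((by fun_prop : Continuous _).intervalIntegrable _ _)]
    refine intervalIntegral.integral_congr fun x _ => ?_
    have := sq_abs (u₀ x)
    nlinarith
  rw [intervalIntegral.integral_sub ((by fun_prop : Continuous _).intervalIntegrable _ _)
    (by simp), intervalIntegral.integral_const_mul, ← hm] at h3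
  simp only [intervalIntegral.integral_const, sub_zero, one_smul] at h3
  have h4 : (datumSize u₀)⁻¹ ^ 2 ≤ m ^ 2 := by gcongr
  nlinarith

/-! ### A priori estimates for solutions -/

theorem exists_abs_le_of_continuous {g : ℝ → ℝ} (hg : Continuous g) (D : ℝ) :
    ∃ F, 0 ≤ F ∧ ∀ y, |y| ≤ D → |g y| ≤ F := by
  obtain ⟨F, hF⟩ := (isCompact_Icc (a := -D) (b := D)).exists_bound_of_continuousOn hg.continuousOn
  exact ⟨max F 0, le_max_right _ _, fun y hy => (hF y (abs_le.1 hy)).trans (le_max_left _ _)⟩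

/-- The estimates which hold uniformly in the viscosity for the solutions with `datumSize u₀ = D`:
an upper bound for the slope, the resulting bound for `u`, the initial energy, and Oleinik's
estimate. -/
structure HasUniformBounds (σ D : ℝ) (u u₁ : ℝ → ℝ → ℝ) : Prop where
  slope_le : ∀ t, 0 ≤ t → ∀ x, u₁ t x ≤ D
  abs_le : ∀ t, 0 ≤ t → ∀ x, |u t x| ≤ D
  initial_slope : ∀ x, |u₁ 0 x| ≤ D
  initial_energy : D⁻¹ ^ 2 ≤ ∫ x in (0 : ℝ)..1, u 0 x ^ 2
  decay : ∀ t, 0 < t → ∀ x, |u t x| ≤ (σ * t)⁻¹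

theorem IsSolution.exists_hasUniformBounds {f : ℝ → ℝ} (hf : ContDiff ℝ ∞ f) {σ : ℝ} (hσ : 0 < σ)
    (hconv : ∀ y, σ ≤ iteratedDeriv 2 f y) {D : ℝ} {ν : ℝ} (hν : 0 < ν) {u₀ : ℝ → ℝ}
    (h₀ : IsInitialDatum u₀) (hD : datumSize u₀ = D) {u : ℝ → ℝ → ℝ} (hu : IsSolution f ν u₀ u) :
    ∃ u₁ u₂ u₃ : ℝ → ℝ → ℝ, IsClassical f ν (fun t => u (max t 0)) u₁ u₂ u₃ ∧
      HasUniformBounds σ D (fun t => u (max t 0)) u₁ := by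
  obtain ⟨u₁, u₂, u₃, h⟩ := hu.exists_isClassical hf
  refine ⟨u₁, u₂, u₃, h, ?_⟩
  have hu0 : u (max 0 0) = u₀ := by
    rw [max_self]
    exact funext hu.initial
  have hinit : ∀ x, |u₁ 0 x| ≤ D := by
    intro x
    have h1 := (h.space₀ 0 x).deriv
    rw [hu0] at h1
    rw [← h1, ← hD]
    exact abs_deriv_le_datumSize h₀ x
  have hD0 : 0 ≤ D := (abs_nonneg _).trans (hinit 0)
  have hmean : ∀ t, 0 ≤ t → ∫ x in (0 : ℝ)..1, u (max t 0) x = 0 := fun t ht =>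
    h.integral_eq_zero hf (by rw [hu0]; exact h₀.zero_mean) ht
  have hslope : ∀ t, 0 ≤ t → ∀ x, u₁ t x ≤ D := fun t ht x =>
    h.slope_le hν hσ hconv hD0 (fun y => (abs_le.1 (hinit y)).2) ht x
  refine ⟨hslope, fun t ht x => ?_, hinit, ?_, fun t ht x => ?_⟩
  · exact abs_le_of_hasDerivAt_le (h.space₀ t) (h.periodic t) (hmean t ht) (hslope t ht) hD0 x
  · rw [hu0, ← hD]
    exact inv_sq_datumSize_le h₀
  · refine abs_le_of_hasDerivAt_le (h.space₀ t) (h.periodic t) (hmean t ht.le) (fun y => ?_)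
      (by positivity) x
    have h1 := h.mul_slope_le hν hσ hconv ht.le y
    rw [mul_inv, ← div_eq_mul_inv, le_div_iff₀ ht]
    linarith

theorem IsClassical.h1NormSq_eq {f : ℝ → ℝ} {ν : ℝ} {u u₁ u₂ u₃ : ℝ → ℝ → ℝ}
    (h : IsClassical f ν (fun t => u (max t 0)) u₁ u₂ u₃) {t : ℝ} (ht : 0 ≤ t) :
    h1NormSq (u t) = ∫ x in (0 : ℝ)..1, u₁ t x ^ 2 := by
  unfold h1NormSq
  refine intervalIntegral.integral_congr fun x _ => ?_
  have h1 := (h.space₀ t x).deriv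
  simp only [max_eq_left ht] at h1
  simp only [h1]

theorem exists_isH1Constant {f : ℝ → ℝ} (hf : ContDiff ℝ ∞ f) {σ : ℝ} (hσ : 0 < σ)
    (hconv : ∀ y, σ ≤ iteratedDeriv 2 f y) {D : ℝ} (hD : 0 < D) :
    ∃ Ct, 0 < Ct ∧ IsH1Constant f D Ct := by
  obtain ⟨F, hF0, hF⟩ := exists_abs_le_of_continuous hf.continuous D
  refine ⟨D * (D + 2 * F), by positivity, ?_⟩
  intro u₀ h₀ hsize ν hν hν1 u hu t ht
  obtain ⟨u₁, u₂, u₃, h, hb⟩ := hu.exists_hasUniformBounds hf hσ hconv hν h₀ hsize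
  rw [h.h1NormSq_eq ht]
  have h1 : ∀ x, -(D + F) ≤ ν * u₁ 0 x - f (u (max 0 0) x) := by
    intro x
    have h2 := abs_le.1 (hb.initial_slope x)
    have h3 := abs_le.1 (hF _ (hb.abs_le 0 le_rfl x))
    nlinarith [mul_le_mul_of_nonneg_right hν1 hD.le]
  have hlow : ∀ x, -((D + 2 * F) / ν) ≤ u₁ t x := by
    intro x
    have h2 := h.le_flux hf hν h1 ht x
    have h3 := abs_le.1 (hF _ (hb.abs_le t ht x))
    rw [← neg_div, div_le_iff₀ hν]
    nlinarith
  have hc1 := h.cont₁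
  have h2 := integral_sq_le_mul (w := u₁ t) (by fun_prop)
    (integral_deriv_periodic (h.space₀ t) (by fun_prop) (h.periodic t)) (hb.slope_le t ht) hlow
  rwa [← mul_div_assoc, div_eq_mul_inv] at h2

section Averages

variable {f : ℝ → ℝ} {ν σ D Ct : ℝ} {u u₁ u₂ u₃ : ℝ → ℝ → ℝ}

theorem T₁_pos (hD : 0 < D) (hCt : 0 < Ct) : 0 < T₁ D Ct := by unfold T₁; positivity

theorem T₁_lt_T₂ (hD : 0 < D) (hCt : 0 < Ct) : T₁ D Ct < T₂ σ D Ct := by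
  have h1 := T₁_pos hD hCt
  exact lt_of_lt_of_le (by linarith) (le_max_left _ _)

/-- Dissipation on `[T₁, T₂]`: by Oleinik's estimate three quarters of the energy is dissipated
before `T₂`, and the definition of `T₁` ensures that at most half of it is dissipated before
`T₁`. -/
theorem IsClassical.le_integral_h1 (h : IsClassical f ν u u₁ u₂ u₃) (hf : ContDiff ℝ ∞ f)
    (hb : HasUniformBounds σ D u u₁) (hν : 0 < ν) (hσ : 0 < σ) (hD : 0 < D) (hCt : 0 < Ct)
    (hP : ∀ t, 0 ≤ t → ∫ x in (0 : ℝ)..1, u₁ t x ^ 2 ≤ Ct * ν⁻¹) :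
    1 / 8 * (D ^ 2)⁻¹ / ν ≤ ∫ t in (T₁ D Ct)..(T₂ σ D Ct), ∫ x in (0 : ℝ)..1, u₁ t x ^ 2 := by
  have hT1 := T₁_pos hD hCt
  have hT12 : T₁ D Ct < T₂ σ D Ct := T₁_lt_T₂ hD hCt
  have hT2 := hT1.trans hT12
  have hc0 := h.cont₀
  have hc1 := h.cont₁
  have hcP : Continuous fun t => ∫ x in (0 : ℝ)..1, u₁ t x ^ 2 :=
    continuous_integral_space (G := fun t x => u₁ t x ^ 2) (by fun_prop)
  have hE := h.energy_eq hf hT2.le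
  rw [← intervalIntegral.integral_add_adjacent_intervals (hcP.intervalIntegrable 0 (T₁ D Ct))
    (hcP.intervalIntegrable (T₁ D Ct) (T₂ σ D Ct))] at hE
  have h1 : ∫ t in (0 : ℝ)..T₁ D Ct, ∫ x in (0 : ℝ)..1, u₁ t x ^ 2 ≤ T₁ D Ct * (Ct * ν⁻¹) := by
    have h2 := intervalIntegral.integral_mono_on (μ := volume) hT1.le
      (hcP.intervalIntegrable 0 (T₁ D Ct)) (by simp : IntervalIntegrable (fun _ => Ct * ν⁻¹)
        volume 0 (T₁ D Ct)) fun t ht => hP t ht.1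
    rwa [intervalIntegral.integral_const, smul_eq_mul, sub_zero] at h2
  have h2 : ∫ x in (0 : ℝ)..1, u (T₂ σ D Ct) x ^ 2 ≤ ((2 * D)⁻¹) ^ 2 := by
    have h3 : ∀ x, u (T₂ σ D Ct) x ^ 2 ≤ ((2 * D)⁻¹) ^ 2 := by
      intro x
      have h4 := hb.decay _ hT2 x
      have h5 : (σ * T₂ σ D Ct)⁻¹ ≤ (2 * D)⁻¹ := by
        refine inv_anti₀ (by positivity) ?_
        have : 2 * D * σ⁻¹ ≤ T₂ σ D Ct := le_max_right _ _
        calc 2 * D = σ * (2 * D * σ⁻¹) := by field_simp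
          _ ≤ _ := by gcongr
      rw [← sq_abs]
      exact pow_le_pow_left₀ (abs_nonneg _) (h4.trans h5) 2
    have h4 := intervalIntegral.integral_mono_on (μ := volume) zero_le_one
      ((by fun_prop : Continuous fun x => u (T₂ σ D Ct) x ^ 2).intervalIntegrable 0 1)
      (by simp : IntervalIntegrable (fun _ => ((2 * D)⁻¹) ^ 2) volume 0 1) fun x _ => h3 x
    simpa using h4
  have h3 := hb.initial_energy
  have h4 : 2 * ν * (T₁ D Ct * (Ct * ν⁻¹)) = 1 / 2 * (D ^ 2)⁻¹ := by
    unfold T₁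
    field_simp
    norm_num
  have h5 : ((2 * D)⁻¹) ^ 2 = 1 / 4 * (D ^ 2)⁻¹ := by
    field_simp
    norm_num
  rw [inv_pow] at h3
  rw [div_le_iff₀ hν]
  nlinarith

/-- The second order norm, integrated in time, is of order `ν⁻³` if the first order norm is of
order `ν⁻¹`. -/
theorem IsClassical.integral_h2_le (h : IsClassical f ν u u₁ u₂ u₃) (hf : ContDiff ℝ ∞ f)
    (hν : 0 < ν) (hν1 : ν ≤ 1) {F S T : ℝ} (hS : 0 ≤ S) (hST : S ≤ T)
    (hF : ∀ t, 0 ≤ t → ∀ x, |deriv f (u t x)| ≤ F)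
    (hP : ∀ t, 0 ≤ t → ∫ x in (0 : ℝ)..1, u₁ t x ^ 2 ≤ Ct * ν⁻¹) :
    ∫ t in S..T, ∫ x in (0 : ℝ)..1, u₂ t x ^ 2 ≤ (Ct + F ^ 2 * (Ct * (T - S))) / ν ^ 3 := by
  have hc1 := h.cont₁
  have hcP : Continuous fun t => ∫ x in (0 : ℝ)..1, u₁ t x ^ 2 :=
    continuous_integral_space (G := fun t x => u₁ t x ^ 2) (by fun_prop)
  have hPle : ∫ t in S..T, ∫ x in (0 : ℝ)..1, u₁ t x ^ 2 ≤ (T - S) * (Ct * ν⁻¹) := by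
    have h2 := intervalIntegral.integral_mono_on (μ := volume) hST
      (hcP.intervalIntegrable S T) (by simp : IntervalIntegrable (fun _ => Ct * ν⁻¹)
        volume S T) fun t ht => hP t (hS.trans ht.1)
    rwa [intervalIntegral.integral_const, smul_eq_mul] at h2
  have hP0 : 0 ≤ ∫ x in (0 : ℝ)..1, u₁ S x ^ 2 :=
    intervalIntegral.integral_nonneg zero_le_one fun x _ => sq_nonneg _
  have h1 := h.integral_second_le hf hν hS hST hF
  have h2 : F ^ 2 / ν * ∫ t in S..T, ∫ x in (0 : ℝ)..1, u₁ t x ^ 2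
      ≤ F ^ 2 / ν * ((T - S) * (Ct * ν⁻¹)) := by gcongr
  have h4 : Ct * ν⁻¹ ≤ Ct / ν ^ 2 := by
    have h0 : 0 ≤ Ct := by
      have := hP0.trans (hP S hS)
      rwa [← div_eq_mul_inv, le_div_iff₀ hν, zero_mul] at this
    rw [← div_eq_mul_inv]
    exact div_le_div_of_nonneg_left h0 (by positivity) (pow_le_of_le_one hν.le hν1 two_ne_zero)
  have h5 : (Ct + F ^ 2 * (Ct * (T - S))) / ν ^ 3
      = (Ct / ν ^ 2 + F ^ 2 / ν * ((T - S) * (Ct * ν⁻¹))) / ν := by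
    field_simp
  rw [h5, le_div_iff₀ hν]
  linarith [hP S hS]

end Averages

/-! ### The energy spectrum -/

theorem continuous_fourierHat {u : ℝ → ℝ → ℝ} (hu : Continuous fun p : ℝ × ℝ => u p.1 p.2)
    (n : ℤ) : Continuous fun t => fourierHat (u t) n := by
  simp only [fourierHat_eq]
  refine intervalIntegral.continuous_parametric_intervalIntegral_of_continuous'
    (f := fun t x => Complex.exp (-(2 * Real.pi * n * x) * Complex.I) * u t x) ?_ 0 1
  have : Continuous fun p : ℝ × ℝ =>
      Complex.exp (-(2 * Real.pi * n * p.2) * Complex.I) * u p.1 p.2 := by fun_prop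
  exact this

/-- The energy spectrum is the time average of the energy of the layer, divided by the number of
frequencies in it. -/
theorem energySpectrum_eq {S T M k : ℝ} (hS : 0 ≤ S) (hST : S ≤ T) (u : ℝ → ℝ → ℝ) :
    energySpectrum S T M u k = (T - S)⁻¹ * ((∫ t in S..T, ∑ n ∈ layer M k,
      ‖fourierHat (u (max t 0)) n‖ ^ 2) / (layer M k).card) := by
  unfold energySpectrum
  rw [interval_average_eq, smul_eq_mul, ← intervalIntegral.integral_div]
  congr 1
  refine intervalIntegral.integral_congr fun t ht => ?_
  rw [uIcc_of_le hST] at ht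
  simp only [max_eq_left (hS.trans ht.1), Finset.sum_const, nsmul_eq_mul, mul_one]

theorem energySpectrum_le {S T M k D : ℝ} (hS : 0 ≤ S) (hST : S < T) (hM : 0 < M) (hk : 0 < k)
    {u : ℝ → ℝ → ℝ} (hc : Continuous fun p : ℝ × ℝ => u (max p.1 0) p.2)
    (hdecay : ∀ t, 0 ≤ t → ∀ n : ℤ, (n : ℝ) ^ 2 * ‖fourierHat (u (max t 0)) n‖ ^ 2 ≤ D ^ 2) :
    energySpectrum S T M u k ≤ D ^ 2 * M ^ 2 * k ^ (-2 : ℤ) := by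
  rw [energySpectrum_eq hS hST.le]
  have hV : ∀ n, Continuous fun t => fourierHat (u (max t 0)) n :=
    fun n => continuous_fourierHat hc n
  have hB : 0 ≤ D ^ 2 * M ^ 2 * k ^ (-2 : ℤ) := by positivity
  have hA : ∫ t in S..T, ∑ n ∈ layer M k, ‖fourierHat (u (max t 0)) n‖ ^ 2
      ≤ (T - S) * ((layer M k).card * (D ^ 2 * M ^ 2 * k ^ (-2 : ℤ))) := by
    rw [← smul_eq_mul (T - S), ← intervalIntegral.integral_const]
    refine intervalIntegral.integral_mono_on hST.le
      ((by fun_prop : Continuous _).intervalIntegrable _ _) (by simp) fun t ht => ?_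
    rw [← nsmul_eq_mul]
    refine Finset.sum_le_card_nsmul _ _ _ fun n hn => ?_
    have h1 := hdecay t (hS.trans ht.1) n
    have h2 : (M⁻¹ * k) ^ 2 ≤ (n : ℝ) ^ 2 := by
      rw [← sq_abs (n : ℝ)]
      have := ((mem_layer M k n).1 hn).1
      gcongr
    have h3 : (M⁻¹ * k) ^ 2 * ‖fourierHat (u (max t 0)) n‖ ^ 2 ≤ D ^ 2 :=
      (mul_le_mul_of_nonneg_right h2 (sq_nonneg _)).trans h1
    calc ‖fourierHat (u (max t 0)) n‖ ^ 2
        = (M⁻¹ * k) ^ 2 * ‖fourierHat (u (max t 0)) n‖ ^ 2 * (M ^ 2 * (k ^ 2)⁻¹) := by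
          field_simp
      _ ≤ D ^ 2 * (M ^ 2 * (k ^ 2)⁻¹) := by gcongr
      _ = D ^ 2 * M ^ 2 * k ^ (-2 : ℤ) := by
          rw [zpow_neg, mul_assoc]
          norm_cast
  rw [inv_mul_le_iff₀ (by linarith)]
  refine div_le_of_le_mul₀ (Nat.cast_nonneg _) (mul_nonneg (by linarith) hB) ?_
  linarith

theorem le_energySpectrum {S T M k A : ℝ} (hS : 0 ≤ S) (hST : S < T) (hMk : 1 ≤ M * k)
    {u : ℝ → ℝ → ℝ}
    (hA : A ≤ ∫ t in S..T, ∑ n ∈ layer M k, ‖fourierHat (u (max t 0)) n‖ ^ 2) :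
    (T - S)⁻¹ * (A / (3 * (M * k))) ≤ energySpectrum S T M u k := by
  rw [energySpectrum_eq hS hST.le]
  have hI : 0 ≤ ∫ t in S..T, ∑ n ∈ layer M k, ‖fourierHat (u (max t 0)) n‖ ^ 2 :=
    intervalIntegral.integral_nonneg hST.le fun t _ => Finset.sum_nonneg fun n _ => sq_nonneg _
  have hTS : 0 ≤ (T - S)⁻¹ := inv_nonneg.2 (by linarith)
  refine mul_le_mul_of_nonneg_left ?_ hTS
  refine (div_le_div_of_nonneg_right hA (by linarith)).trans ?_
  rcases (layer M k).eq_empty_or_nonempty with h | h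
  -- An empty layer has spectrum `0 / 0 = 0` and carries no energy.
  · simp [h]
  · exact div_le_div_of_nonneg_left hI (Nat.cast_pos.2 h.card_pos) (card_layer_le hMk)

/-- The lower bound for the energy in the layer around `k = l⁻¹`, integrated in time. The scale
`r` is the one at which gradients are resolved; every step is linear in the time-dependent
quantities, so that only the time integrals of the first and second order norms enter. -/
theorem IsClassical.le_integral_layer {f : ℝ → ℝ} {ν : ℝ} {u u₁ u₂ u₃ : ℝ → ℝ → ℝ}
    (h : IsClassical f ν u u₁ u₂ u₃) {D : ℝ} (hD : 0 < D)
    (hslope : ∀ t, 0 ≤ t → ∀ x, u₁ t x ≤ D) {S T : ℝ} (hS : 0 ≤ S) (hST : S ≤ T)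
    {M k r a : ℝ} (hM : 0 < M) (hk : 1 ≤ k) (hr : 0 < r) (hrk : r ≤ k⁻¹) (ha : 0 ≤ a) :
    (k⁻¹ - r) * (2 * a * (r / D * ((∫ t in S..T, ∫ x in (0 : ℝ)..1, u₁ t x ^ 2)
        - r ^ 2 / 4 * ∫ t in S..T, ∫ x in (0 : ℝ)..1, u₂ t x ^ 2) - D * k⁻¹ * (T - S))
        - a ^ 2 * (T - S))
      ≤ 4 * (∫ t in S..T, ∑ n ∈ layer M k, ‖fourierHat (u t) n‖ ^ 2)
        + 100 * D ^ 2 * k⁻¹ / M * (T - S) := by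
  have hc0 := h.cont₀
  have hc1 := h.cont₁
  have hc2 := h.cont₂
  have hk0 : 0 < k := by linarith
  have hcP : Continuous fun t => ∫ x in (0 : ℝ)..1, u₁ t x ^ 2 :=
    continuous_integral_space (G := fun t x => u₁ t x ^ 2) (by fun_prop)
  have hcQ : Continuous fun t => ∫ x in (0 : ℝ)..1, u₂ t x ^ 2 :=
    continuous_integral_space (G := fun t x => u₂ t x ^ 2) (by fun_prop)
  have hV : ∀ n, Continuous fun t => fourierHat (u t) n := fun n => continuous_fourierHat hc0 n
  have hcA : Continuous fun t => ∑ n ∈ layer M k, ‖fourierHat (u t) n‖ ^ 2 := by fun_prop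
  set P := fun t => ∫ x in (0 : ℝ)..1, u₁ t x ^ 2 with hP
  set Q := fun t => ∫ x in (0 : ℝ)..1, u₂ t x ^ 2 with hQ
  set A := fun t => ∑ n ∈ layer M k, ‖fourierHat (u t) n‖ ^ 2 with hA
  have hpt : ∀ t ∈ Icc S T,
      (k⁻¹ - r) * (2 * a * (r / D * (P t - r ^ 2 / 4 * Q t) - D * k⁻¹) - a ^ 2)
        ≤ 4 * A t + 100 * D ^ 2 * k⁻¹ / M := by
    intro t ht
    have ht0 := hS.trans ht.1
    have h1 := le_integral_increment_sq_of_deriv (h.space₀ t) (h.space₁ t) (by fun_prop)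
      (h.periodic t) r
    have h2 := increment_sq_transfer (h.space₀ t) (h.periodic t) (hslope t ht0) hD hr hrk
      (inv_le_one_of_one_le₀ hk) ha
    have h3 := increment_sq_le_layer (h.space₀ t) (by fun_prop) (h.periodic t) (hslope t ht0)
      hD.le hM hk0
    refine le_trans ?_ (h2.trans h3)
    have h4 : r / D * (P t - r ^ 2 / 4 * Q t)
        ≤ (D * r)⁻¹ * ∫ x in (0 : ℝ)..1, (u t (x + r) - u t x) ^ 2 := by
      calc r / D * (P t - r ^ 2 / 4 * Q t)
          = (D * r)⁻¹ * (r ^ 2 * P t - r ^ 4 / 4 * Q t) := by field_simp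
        _ ≤ _ := by gcongr
    have : 0 ≤ k⁻¹ - r := by linarith
    gcongr
  have h1 := intervalIntegral.integral_mono_on (μ := volume) hST
    ((by fun_prop : Continuous fun t =>
      (k⁻¹ - r) * (2 * a * (r / D * (P t - r ^ 2 / 4 * Q t) - D * k⁻¹)
        - a ^ 2)).intervalIntegrable S T)
    ((by fun_prop : Continuous fun t => 4 * A t + 100 * D ^ 2 * k⁻¹ / M).intervalIntegrable S T)
    hpt
  rw [intervalIntegral.integral_const_mul, intervalIntegral.integral_sub
    ((by fun_prop : Continuous _).intervalIntegrable _ _) (by simp),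
    intervalIntegral.integral_const_mul, intervalIntegral.integral_sub
    ((by fun_prop : Continuous _).intervalIntegrable _ _) (by simp),
    intervalIntegral.integral_const_mul, intervalIntegral.integral_sub
    (hcP.intervalIntegrable _ _) ((by fun_prop : Continuous _).intervalIntegrable _ _),
    intervalIntegral.integral_const_mul, intervalIntegral.integral_add
    ((by fun_prop : Continuous _).intervalIntegrable _ _) (by simp),
    intervalIntegral.integral_const_mul, intervalIntegral.integral_const,
    intervalIntegral.integral_const, intervalIntegral.integral_const, smul_eq_mul, smul_eq_mul,
    smul_eq_mul, intervalIntegral.integral_const_mul] at h1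
  linarith

/-- The constants in the lower bound: with gradients resolved at the scale `r = C₁ ν / 2`, the
average drop of `u` over the distance `r` dominates the possible increase over the distance `k⁻¹`,
and a wide layer absorbs the remaining frequencies. -/
theorem le_integral_layer_of_inertialRange {D τ p q C₁ C₂ ν k M a P Q A : ℝ} (hD : 0 < D)
    (hτ : 0 < τ) (hp : 0 < p) (hC₁ : 0 < C₁) (hν : 0 < ν) (hk : 0 < k)
    (hP : p / ν ≤ P) (hQ : Q ≤ q / ν ^ 3) (hq : C₁ ^ 2 * q ≤ 8 * p)
    (hC₂ : 8 * D ^ 2 * τ * C₂ ≤ C₁ * p) (hkν : C₁ * ν < k⁻¹) (hkC₂ : k⁻¹ ≤ C₂)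
    (ha : a = C₁ * p / (8 * D * τ)) (hM : 0 < M) (haM : 400 * D ^ 2 ≤ a ^ 2 * M)
    (hmain : (k⁻¹ - C₁ * ν / 2) * (2 * a * (C₁ * ν / 2 / D * (P - (C₁ * ν / 2) ^ 2 / 4 * Q)
      - D * k⁻¹ * τ) - a ^ 2 * τ) ≤ 4 * A + 100 * D ^ 2 * k⁻¹ / M * τ) :
    a ^ 2 / 16 * τ * k⁻¹ ≤ A := by
  have ha0 : 0 < a := by rw [ha]; positivity
  have hk' : 0 < k⁻¹ := inv_pos.2 hk
  have h1 : 2 * (a * τ) ≤ C₁ * ν / 2 / D * (P - (C₁ * ν / 2) ^ 2 / 4 * Q) := by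
    have h2 : p / (2 * ν) ≤ P - (C₁ * ν / 2) ^ 2 / 4 * Q := by
      have h3 : (C₁ * ν / 2) ^ 2 / 4 * Q ≤ (C₁ * ν / 2) ^ 2 / 4 * (q / ν ^ 3) := by gcongr
      have h4 : (C₁ * ν / 2) ^ 2 / 4 * (q / ν ^ 3) = C₁ ^ 2 * q / (16 * ν) := by
        field_simp
        ring
      have h5 : C₁ ^ 2 * q / (16 * ν) ≤ 8 * p / (16 * ν) := by gcongr
      have h6 : 8 * p / (16 * ν) = p / (2 * ν) := by
        field_simp
        norm_num
      have h7 : p / ν = 2 * (p / (2 * ν)) := by field_simp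
      linarith
    calc 2 * (a * τ) = C₁ * ν / 2 / D * (p / (2 * ν)) := by
          rw [ha]
          field_simp
          norm_num
      _ ≤ _ := by gcongr
  have h2 : D * k⁻¹ * τ ≤ a * τ := by
    have h3 : D * k⁻¹ * τ ≤ D * C₂ * τ := by gcongr
    have h4 : D * C₂ * τ ≤ a * τ := by
      rw [ha]
      have : C₁ * p / (8 * D * τ) * τ = C₁ * p / (8 * D) := by field_simp
      rw [this, le_div_iff₀ (by positivity)]
      linarith
    linarith
  have h3 : a ^ 2 * τ ≤ 2 * a * (C₁ * ν / 2 / D * (P - (C₁ * ν / 2) ^ 2 / 4 * Q)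
      - D * k⁻¹ * τ) - a ^ 2 * τ := by nlinarith
  have h4 : k⁻¹ / 2 ≤ k⁻¹ - C₁ * ν / 2 := by linarith
  have h5 : k⁻¹ / 2 * (a ^ 2 * τ) ≤ 4 * A + 100 * D ^ 2 * k⁻¹ / M * τ :=
    (mul_le_mul h4 h3 (by positivity) (by linarith)).trans hmain
  have h6 : 100 * D ^ 2 * k⁻¹ / M * τ ≤ a ^ 2 / 4 * k⁻¹ * τ := by
    gcongr
    rw [div_le_iff₀ hM]
    nlinarith
  linarith

/-- A large constant `K` puts the scale `C₁ ν` into the range where gradients are resolved, and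
makes the largest scale `C₂` of the inertial range small compared with `C₁`. -/
theorem inertialRange_constraints {p q b K C₁ C₂ : ℝ} (hp : 0 < p) (hq : 0 < q) (hb : 0 < b)
    (hK : K = 1 + q / p + b / p) (hC₁ : 0 < C₁) (hC₂ : 0 < C₂) (hC₁K : C₁ ≤ 1 / 4 * (K ^ 2)⁻¹)
    (hC₁₂ : 5 * K ^ 2 ≤ C₁ / C₂) : C₁ ^ 2 * q ≤ 8 * p ∧ b * C₂ ≤ C₁ * p := by
  have hqp : 0 < q / p := by positivity
  have hbp : 0 < b / p := by positivity
  have hK1 : 1 ≤ K := by linarith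
  have hKK : K ≤ K ^ 2 := le_self_pow₀ hK1 two_ne_zero
  have hKq : q ≤ K ^ 2 * p := (div_le_iff₀ hp).1 (by linarith)
  have hKb : b ≤ K ^ 2 * p := (div_le_iff₀ hp).1 (by linarith)
  have h1 : C₁ * K ^ 2 ≤ 1 / 4 := by
    rwa [← div_eq_mul_inv, le_div_iff₀ (by positivity)] at hC₁K
  have h2 : C₁ ≤ 1 := by
    have : C₁ * 1 ≤ C₁ * K ^ 2 := by
      gcongr
      linarith
    linarith
  constructor
  · calc C₁ ^ 2 * q ≤ C₁ ^ 2 * (K ^ 2 * p) := by gcongr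
      _ = C₁ * (C₁ * K ^ 2) * p := by ring
      _ ≤ 1 * (1 / 4) * p := by gcongr
      _ ≤ 8 * p := by linarith
  · rw [le_div_iff₀ hC₂] at hC₁₂
    have h3 : 0 ≤ K ^ 2 * C₂ * p := by positivity
    calc b * C₂ ≤ K ^ 2 * p * C₂ := by gcongr
      _ ≤ 5 * K ^ 2 * C₂ * p := by linarith
      _ ≤ C₁ * p := by gcongr

end

end Burgers

theorem theorem6p11 (f : ℝ → ℝ) (hf : ContDiff ℝ ∞ f) (σ : ℝ) (hσ : 0 < σ)
    (hconv : ∀ y, σ ≤ iteratedDeriv 2 f y) (D : ℝ) (hD : 1 < D) :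
    (∃ Ct : ℝ, 0 < Ct ∧ Burgers.IsH1Constant f D Ct) ∧
    ∀ Ct : ℝ, 0 < Ct → Burgers.IsH1Constant f D Ct →
      ∃ K : ℝ, 1 < K ∧
        ∀ C₁ C₂ ν₀ : ℝ, 0 < C₁ → 0 < C₂ → 0 < ν₀ →
          C₁ ≤ 1 / 4 * (K ^ 2)⁻¹ → 5 * K ^ 2 ≤ C₁ / C₂ → C₁ / C₂ < 1 / ν₀ →
          ∃ M : ℝ, 1 ≤ M ∧ ∃ C : ℝ, 0 < C ∧
            ∀ u₀ : ℝ → ℝ, Burgers.IsInitialDatum u₀ → Burgers.datumSize u₀ = D →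
            ∀ ν : ℝ, 0 < ν → ν ≤ ν₀ →
            ∀ u : ℝ → ℝ → ℝ, Burgers.IsSolution f ν u₀ u →
            ∀ k : ℝ, 1 ≤ k → k⁻¹ ∈ Burgers.inertialRange C₁ C₂ ν →
              C⁻¹ * k ^ (-2 : ℤ) ≤
                Burgers.energySpectrum (Burgers.T₁ D Ct) (Burgers.T₂ σ D Ct) M u k ∧
              Burgers.energySpectrum (Burgers.T₁ D Ct) (Burgers.T₂ σ D Ct) M u k ≤
                C * k ^ (-2 : ℤ) := by
  have hD0 : 0 < D := by linarith
  refine ⟨Burgers.exists_isH1Constant hf hσ hconv hD0, fun Ct hCt hH => ?_⟩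
  obtain ⟨F, hF0, hF⟩ :=
    Burgers.exists_abs_le_of_continuous (Burgers.continuous_deriv_flux hf) D
  have hT1 := Burgers.T₁_pos hD0 hCt
  have hT12 : Burgers.T₁ D Ct < Burgers.T₂ σ D Ct := Burgers.T₁_lt_T₂ hD0 hCt
  set S := Burgers.T₁ D Ct with hS
  set T := Burgers.T₂ σ D Ct with hT
  set τ := T - S with hτdef
  have hτ : 0 < τ := sub_pos.2 hT12
  -- `p ν⁻¹` bounds the time integral of the first order norm from below, `q ν⁻³` that of the
  -- second order norm from above.
  set p := 1 / 8 * (D ^ 2)⁻¹ with hp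
  have hp0 : 0 < p := by positivity
  set q := Ct + F ^ 2 * (Ct * τ) with hq
  have hq0 : 0 < q := by positivity
  set K := 1 + q / p + 8 * D ^ 2 * τ / p with hK
  have hK1 : 1 < K := by
    have : 0 < q / p := by positivity
    have : 0 < 8 * D ^ 2 * τ / p := by positivity
    linarith
  refine ⟨K, hK1, fun C₁ C₂ ν₀ hC₁ hC₂ hν₀ hC₁K hC₁₂ hC₁₂ν => ?_⟩
  have hν₀1 : ν₀ ≤ 1 := by
    have h0 : 1 < K ^ 2 := one_lt_pow₀ hK1 two_ne_zero
    have h1 : 1 < 1 / ν₀ := by linarith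
    rw [lt_div_iff₀ hν₀] at h1
    linarith
  obtain ⟨hC₁q, hC₂τ⟩ := Burgers.inertialRange_constraints hp0 hq0 (by positivity) hK hC₁ hC₂ hC₁K
    hC₁₂
  -- At the scale `C₁ ν / 2` the mean drop of `u` is at least `2 a`.
  set a := C₁ * p / (8 * D * τ) with ha
  have ha0 : 0 < a := by positivity
  set M := max 1 (400 * D ^ 2 / a ^ 2) with hM
  have hM1 : 1 ≤ M := le_max_left _ _
  have hM0 : 0 < M := by linarith
  have haM : 400 * D ^ 2 ≤ a ^ 2 * M := by
    have : 400 * D ^ 2 / a ^ 2 ≤ M := le_max_right _ _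
    rw [div_le_iff₀ (by positivity)] at this
    linarith
  set C := D ^ 2 * M ^ 2 + 48 * M / a ^ 2 with hC
  refine ⟨M, hM1, C, by positivity, ?_⟩
  intro u₀ h₀ hsize ν hν hνν₀ u hu k hk hkJ
  have hν1 : ν ≤ 1 := hνν₀.trans hν₀1
  have hk0 : 0 < k := by linarith
  have hkz : k ^ (-2 : ℤ) = k⁻¹ * k⁻¹ := by
    rw [zpow_neg, ← mul_inv, ← pow_two]
    norm_cast
  obtain ⟨u₁, u₂, u₃, h, hb⟩ := hu.exists_hasUniformBounds hf hσ hconv hν h₀ hsize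
  have hc1 := h.cont₁
  have hPt : ∀ t, 0 ≤ t → ∫ x in (0 : ℝ)..1, u₁ t x ^ 2 ≤ Ct * ν⁻¹ := fun t ht => by
    rw [← h.h1NormSq_eq ht]
    exact hH u₀ h₀ hsize ν hν hν1 u hu t ht
  constructor
  · have hP := h.le_integral_h1 hf hb hν hσ hD0 hCt hPt
    have hQ : ∫ t in S..T, ∫ x in (0 : ℝ)..1, u₂ t x ^ 2 ≤ q / ν ^ 3 :=
      h.integral_h2_le hf hν hν1 hT1.le hT12.le (fun t ht x => hF _ (hb.abs_le t ht x)) hPt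
    have hr : 0 < C₁ * ν / 2 := by positivity
    have hkJ1 : C₁ * ν < k⁻¹ := hkJ.1
    have hmain := h.le_integral_layer hD0 hb.slope_le hT1.le hT12.le (M := M) (k := k)
      (r := C₁ * ν / 2) (a := a) hM0 hk hr (by linarith) ha0.le
    have hA := Burgers.le_integral_layer_of_inertialRange hD0 hτ hp0 hC₁ hν hk0 hP hQ hC₁q
      hC₂τ hkJ1 hkJ.2 ha hM0 haM hmain
    refine le_trans ?_ (Burgers.le_energySpectrum hT1.le hT12
      (one_le_mul_of_one_le_of_one_le hM1 hk) hA)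
    have h1 : (T - S)⁻¹ * (a ^ 2 / 16 * τ * k⁻¹ / (3 * (M * k)))
        = (48 * M / a ^ 2)⁻¹ * k ^ (-2 : ℤ) := by
      rw [hkz, ← hτdef]
      field_simp
      norm_num
    rw [h1]
    gcongr
    rw [hC]
    have : 0 ≤ D ^ 2 * M ^ 2 := by positivity
    linarith
  · refine (Burgers.energySpectrum_le (D := D) hT1.le hT12 hM0 hk0 h.cont₀ fun t ht n => ?_).trans ?_
    · exact Burgers.mul_norm_fourierHat_le (h.space₀ t) (by fun_prop) (h.periodic t)
        (hb.slope_le t ht) hD0.le n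
    · gcongr
      rw [hC]
      have : 0 ≤ 48 * M / a ^ 2 := by positivity
      linarith
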